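/- **Theorem (nominal partial-state feedback matching).** Consider the plant $\dot x=Ax+Bu$, $y=Cx$ with $A\in\mathbb R^{n\times n}$, $B\in\mathbb R^{n\times M}$, $C\in\mathbb R^{M\times n}$ and transfer matrix $G(s)=C(sI-A)^{-1}B$, and let $y_0=C_0x$ with $C_0\in\mathbb R^{n_0\times n}$. "Stable" means that the roots, zeros or eigenvalues in question lie in the open left half plane. Assume: - (A1) all transmission zeros of $G(s)$ are stable, and $(A,B,C)$ is stabilizable and detectable; - (A2) $G(s)$ has full rank, and $\xi_m(s)$ is a modified left interactor matrix of $G(s)$: a real lower triangular polynomial matrix whose diagonal entries are monic stable polynomials of positive degree, such that $K_p=\lim_{s\to\infty}\xi_m(s)G(s)$ exists, is finite and nonsingular; - (A3) $\operatorname{rank}C_0=n_0$ and $(A,C_0)$ is observable. Let $\Lambda(s)$ be any real monic stable polynomial of degree $n-n_0$, and put $A_1(s)=[I_M,sI_M,\dots,s^{n-n_0-1}I_M]^{\rm T}$, $A_2(s)=[I_{n_0},sI_{n_0},\dots,s^{n-n_0-1}I_{n_0}]^{\rm T}$. Here $w=W(s)[v]$, for a stable strictly proper rational matrix $W$, means that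 $w$ is the output, from some initial condition, of an internally stable state-space realization of $W$ with input $v$; differential equations are understood in the Carathéodory sense on $[0,\infty)$. Then there exist constant matrices $\Theta_1^*\in\mathbb R^{M(n-n_0)\times M}$, $\Theta_2^*\in\mathbb R^{n_0(n-n_0)\times M}$, $\Theta_{20}^*\in\mathbb R^{n_0\times M}$, $\Theta_3^*\in\mathbb R^{M\times M}$ such that for every bounded measurable reference input $r:[0,\infty)\to\mathbb R^M$ the controller $$u(t)=\Theta_1^{*\rm T}\omega_1(t)+\Theta_2^{*\rm T}\omega_2(t)+\Theta_{20}^{*\rm T}y_0(t)+\Theta_3^*r(t),\qquad \omega_1=\frac{A_1(s)}{\Lambda(s)}[u],\quad \omega_2=\frac{A_2(s)}{\Lambda(s)}[y_0],$$ has the following properties. The closed loop has a solution for every initial state $x(0)$, and the reference model $y_m=\xi_m^{-1}(s)[r]$ has a solution. For every solution of the closed loop and every output $y_m$ of the reference model, from whatever initial conditions, the signals $x,u,y,y_0,\omega_1,\omega_2$ are bounded on $[0,\infty)$, and $y(t)-y_m(t)$ is exponentially decaying: $\|y(t)-y_m(t)\|\le c\,e^{-\mu t}$ for all $t\ge0$,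 for some constants $c$ and $\mu>0$. -/

import Mathlib

open scoped Matrix Polynomial Topology

noncomputable section

namespace PartialStateMRC

/-- A real polynomial is stable if all its complex roots lie in the open left half plane. -/
def IsStablePoly (p : ℝ[X]) : Prop :=
  ∀ z : ℂ, Polynomial.aeval z p = 0 → z.re < 0

/-- A real square matrix is Hurwitz if all its eigenvalues lie in the open left half plane. -/
def IsHurwitz {k : ℕ} (F : Matrix (Fin k) (Fin k) ℝ) : Prop :=
  IsStablePoly F.charpoly

/-- `(A, B)` is stabilizable: some state feedback makes `A + B K` Hurwitz. -/
def IsStabilizable {n M : ℕ} (A : Matrix (Fin n) (Fin n) ℝ) (B : Matrix (Fin n) (Fin M) ℝ) :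
    Prop :=
  ∃ K : Matrix (Fin M) (Fin n) ℝ, IsHurwitz (A + B * K)

/-- `(A, C)` is detectable: some output injection makes `A - L C` Hurwitz. -/
def IsDetectable {n p : ℕ} (A : Matrix (Fin n) (Fin n) ℝ) (C : Matrix (Fin p) (Fin n) ℝ) :
    Prop :=
  ∃ L : Matrix (Fin n) (Fin p) ℝ, IsHurwitz (A - L * C)

/-- `(A, C)` is observable: the observability matrix with blocks `C, C A, …, C A ^ (n - 1)`
has trivial kernel (equivalently, full column rank). -/
def IsObservable {n p : ℕ} (A : Matrix (Fin n) (Fin n) ℝ) (C : Matrix (Fin p) (Fin n) ℝ) :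
    Prop :=
  ∀ v : Fin n → ℝ, (∀ k < n, (C * A ^ k) *ᵥ v = 0) → v = 0

/-- The transfer matrix `C (s I - A)⁻¹ B` as a function of the complex variable `s`.
(At the finitely many eigenvalues of `A` the value is meaningless.) -/
def transferMatrix {k : ℕ} {p q : Type*} (A : Matrix (Fin k) (Fin k) ℝ)
    (B : Matrix (Fin k) q ℝ) (C : Matrix p (Fin k) ℝ) (s : ℂ) : Matrix p q ℂ :=
  C.map (fun a : ℝ => (a : ℂ)) *
    (s • (1 : Matrix (Fin k) (Fin k) ℂ) - A.map (fun a : ℝ => (a : ℂ)))⁻¹ *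
      B.map (fun a : ℝ => (a : ℂ))

/-- A square rational matrix has full rank (over the field of rational functions): its value is
nonsingular for all but finitely many `s`. -/
def HasFullRank {M : ℕ} (G : ℂ → Matrix (Fin M) (Fin M) ℂ) : Prop :=
  ∀ᶠ s in Filter.cofinite, (G s).rank = M

/-- `z` is a transmission zero of the square full rank rational matrix `G`: there is a direction
`v(s)`, holomorphic near `z` with `v(z) ≠ 0`, along which `G(s) v(s)` vanishes at `z`.
If `z` is not a pole of `G`, this says that `G(z)` is singular. If `z` is also a pole of `G`, the
definition still gives the zeros of the Smith-McMillan form. -/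
def IsTransmissionZero {M : ℕ} (G : ℂ → Matrix (Fin M) (Fin M) ℂ) (z : ℂ) : Prop :=
  ∃ v : ℂ → Fin M → ℂ, AnalyticAt ℂ v z ∧ v z ≠ 0 ∧
    Filter.Tendsto (fun s => G s *ᵥ v s) (𝓝[≠] z) (𝓝 0)

/-- Evaluation of a real polynomial matrix at a complex number. -/
def evalPolyMatrix {M : ℕ} (ξ : Matrix (Fin M) (Fin M) ℝ[X]) (s : ℂ) :
    Matrix (Fin M) (Fin M) ℂ :=
  ξ.map (fun p => Polynomial.aeval s p)

/-- `ξ` is a modified left interactor matrix of `G`: a lower triangular polynomial matrix whose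
diagonal entries are monic stable polynomials of positive degree, such that `ξ(s) G(s)` has a
finite and nonsingular limit (the high-frequency gain matrix) as `s → ∞`. -/
structure IsModifiedLeftInteractor {M : ℕ} (ξ : Matrix (Fin M) (Fin M) ℝ[X])
    (G : ℂ → Matrix (Fin M) (Fin M) ℂ) : Prop where
  lower : ∀ i j, i < j → ξ i j = 0
  monic : ∀ i, (ξ i i).Monic
  stable : ∀ i, IsStablePoly (ξ i i)
  degree_pos : ∀ i, 0 < (ξ i i).natDegree
  gain : ∃ Kp : Matrix (Fin M) (Fin M) ℝ, Kp.det ≠ 0 ∧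
    Filter.Tendsto (fun s => evalPolyMatrix ξ s * G s) (Bornology.cobounded ℂ)
      (𝓝 (Kp.map (fun a : ℝ => (a : ℂ))))

/-- `x` solves `x' = A x + B u` on `[0, ∞)` in the sense of Carathéodory (for locally integrable
inputs `u`), written as an integral equation. -/
structure IsTrajectory {k : ℕ} {q : Type*} [Fintype q] (A : Matrix (Fin k) (Fin k) ℝ)
    (B : Matrix (Fin k) q ℝ) (u : ℝ → q → ℝ) (x : ℝ → Fin k → ℝ) : Prop where
  input_integrable : ∀ t, 0 ≤ t → IntervalIntegrable u MeasureTheory.volume 0 t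
  continuousOn : ContinuousOn x (Set.Ici 0)
  eq : ∀ t, 0 ≤ t → x t = x 0 + ∫ τ in (0 : ℝ)..t, (A *ᵥ x τ + B *ᵥ u τ)

/-- `y = W(s)[u]` for a stable strictly proper rational matrix `W`: `y` is the output, from some
initial condition, of an internally stable state-space realization of `W` driven by `u`.
(The realization and `W` are compared on the closed right half plane, where neither has poles.
Two outputs for the same input differ by an exponentially decaying term.) -/
def IsResponse {p q : Type*} [Fintype q] (W : ℂ → Matrix p q ℂ)
    (u : ℝ → q → ℝ) (y : ℝ → p → ℝ) : Prop :=
  ∃ (k : ℕ) (F : Matrix (Fin k) (Fin k) ℝ) (H : Matrix (Fin k) q ℝ) (J : Matrix p (Fin k) ℝ)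
    (z : ℝ → Fin k → ℝ),
    IsHurwitz F ∧ (∀ s : ℂ, 0 ≤ s.re → transferMatrix F H J s = W s) ∧
      IsTrajectory F H u z ∧ ∀ t, 0 ≤ t → y t = J *ᵥ z t

/-- The regressor filter `[I, s I, …, s ^ (d - 1) I]ᵀ / Λ(s)` with `q × q` identity blocks; the
row index `(j, i)` stands for row `i` of block `j`. -/
def regressorFilter (d q : ℕ) (Λ : ℝ[X]) (s : ℂ) : Matrix (Fin d × Fin q) (Fin q) ℂ :=
  fun ji l => if ji.2 = l then s ^ (ji.1 : ℕ) / Polynomial.aeval s Λ else 0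

/-- The closed loop of the plant `x' = A x + B u` with the partial-state feedback controller
`u = Θ₁ᵀ ω₁ + Θ₂ᵀ ω₂ + Θ₂₀ᵀ y₀ + Θ₃ r`, where `y₀ = C₀ x`,
`ω₁ = (A₁(s) / Λ(s))[u]` and `ω₂ = (A₂(s) / Λ(s))[y₀]`, on `[0, ∞)`. -/
structure IsClosedLoop {n M n₀ : ℕ} (A : Matrix (Fin n) (Fin n) ℝ)
    (B : Matrix (Fin n) (Fin M) ℝ) (C₀ : Matrix (Fin n₀) (Fin n) ℝ) (Λ : ℝ[X])
    (Θ₁ : Matrix (Fin (n - n₀) × Fin M) (Fin M) ℝ)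
    (Θ₂ : Matrix (Fin (n - n₀) × Fin n₀) (Fin M) ℝ)
    (Θ₂₀ : Matrix (Fin n₀) (Fin M) ℝ) (Θ₃ : Matrix (Fin M) (Fin M) ℝ)
    (r : ℝ → Fin M → ℝ) (x : ℝ → Fin n → ℝ) (u : ℝ → Fin M → ℝ)
    (ω₁ : ℝ → Fin (n - n₀) × Fin M → ℝ) (ω₂ : ℝ → Fin (n - n₀) × Fin n₀ → ℝ) : Prop where
  plant : IsTrajectory A B u x
  filter_input : IsResponse (regressorFilter (n - n₀) M Λ) u ω₁
  filter_partial_state : IsResponse (regressorFilter (n - n₀) n₀ Λ) (fun t => C₀ *ᵥ x t) ω₂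
  control : ∀ t, 0 ≤ t →
    u t = Θ₁ᵀ *ᵥ ω₁ t + Θ₂ᵀ *ᵥ ω₂ t + Θ₂₀ᵀ *ᵥ (C₀ *ᵥ x t) + Θ₃ *ᵥ r t

/-- The signal is bounded on `[0, ∞)`. -/
def IsBoundedSignal {p : Type*} [Fintype p] (f : ℝ → p → ℝ) : Prop :=
  ∃ b : ℝ, ∀ t, 0 ≤ t → ‖f t‖ ≤ b

/-- The signal decays exponentially on `[0, ∞)`. -/
def IsExpDecaying {p : Type*} [Fintype p] (f : ℝ → p → ℝ) : Prop :=
  ∃ c μ : ℝ, 0 < μ ∧ ∀ t, 0 ≤ t → ‖f t‖ ≤ c * Real.exp (-μ * t)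

end PartialStateMRC

end

noncomputable section

namespace PartialStateMRC

open MeasureTheory Set
open scoped Kronecker

/-- `z' = w` on `[0, ∞)` in the sense of Carathéodory. -/
structure HasVelocity {E : Type*} [NormedAddCommGroup E] [NormedSpace ℝ E] (z w : ℝ → E) :
    Prop where
  integrable : ∀ t, 0 ≤ t → IntervalIntegrable w volume 0 t
  continuousOn : ContinuousOn z (Ici 0)
  eq : ∀ t, 0 ≤ t → z t = z 0 + ∫ τ in (0 : ℝ)..t, w τ

/-- `f` is dominated by a multiple of `exp (-μ t)` on `[0, ∞)`. -/
def DecaysAt {E : Type*} [Norm E] (μ : ℝ) (f : ℝ → E) : Prop :=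
  ∃ c : ℝ, ∀ t, 0 ≤ t → ‖f t‖ ≤ c * Real.exp (-μ * t)

namespace HasVelocity

variable {E F : Type*} [NormedAddCommGroup E] [NormedSpace ℝ E] [NormedAddCommGroup F]
  [NormedSpace ℝ F]

lemma map [CompleteSpace E] [CompleteSpace F] {z w : ℝ → E} (h : HasVelocity z w)
    (T : E →L[ℝ] F) : HasVelocity (fun t => T (z t)) (fun t => T (w t)) where
  integrable t ht :=
    ⟨T.integrable_comp (h.integrable t ht).1, T.integrable_comp (h.integrable t ht).2⟩
  continuousOn := T.continuous.comp_continuousOn h.continuousOn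
  eq t ht := by
    rw [T.intervalIntegral_comp_comm (h.integrable t ht), ← map_add, ← h.eq t ht]

lemma add {z w z' w' : ℝ → E} (h : HasVelocity z w) (h' : HasVelocity z' w') :
    HasVelocity (fun t => z t + z' t) (fun t => w t + w' t) where
  integrable t ht := (h.integrable t ht).add (h'.integrable t ht)
  continuousOn := h.continuousOn.add h'.continuousOn
  eq t ht := by
    rw [intervalIntegral.integral_add (h.integrable t ht) (h'.integrable t ht)]
    rw [h.eq t ht, h'.eq t ht]; abel

lemma sub {z w z' w' : ℝ → E} (h : HasVelocity z w) (h' : HasVelocity z' w') :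
    HasVelocity (fun t => z t - z' t) (fun t => w t - w' t) where
  integrable t ht := (h.integrable t ht).sub (h'.integrable t ht)
  continuousOn := h.continuousOn.sub h'.continuousOn
  eq t ht := by
    rw [intervalIntegral.integral_sub (h.integrable t ht) (h'.integrable t ht)]
    rw [h.eq t ht, h'.eq t ht]; abel

lemma congr {z w z' w' : ℝ → E} (h : HasVelocity z w) (hz : ∀ t, 0 ≤ t → z' t = z t)
    (hw : ∀ t, 0 ≤ t → w' t = w t) : HasVelocity z' w' where
  integrable t ht := (h.integrable t ht).congr fun s hs => by
    rw [uIoc_of_le ht] at hs; exact (hw s hs.1.le).symm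
  continuousOn := h.continuousOn.congr hz
  eq t ht := by
    rw [hz t ht, hz 0 le_rfl, h.eq t ht]
    congr 1
    refine intervalIntegral.integral_congr fun s hs => ?_
    rw [uIcc_of_le ht] at hs
    exact (hw s hs.1).symm

end HasVelocity

namespace DecaysAt

variable {E F : Type*} [NormedAddCommGroup E] [NormedAddCommGroup F]

lemma mono {μ ν : ℝ} {f : ℝ → E} (h : DecaysAt μ f) (hν : ν ≤ μ) : DecaysAt ν f := by
  obtain ⟨c, hc⟩ := h
  refine ⟨|c|, fun t ht => (hc t ht).trans ?_⟩
  gcongr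
  exact le_abs_self c

lemma of_le {μ : ℝ} {f : ℝ → E} {g : ℝ → F} (h : DecaysAt μ f) (b : ℝ)
    (hg : ∀ t, 0 ≤ t → ‖g t‖ ≤ b * ‖f t‖) : DecaysAt μ g := by
  obtain ⟨c, hc⟩ := h
  refine ⟨|b| * c, fun t ht => (hg t ht).trans ?_⟩
  calc b * ‖f t‖ ≤ |b| * ‖f t‖ := by gcongr; exact le_abs_self b
    _ ≤ |b| * (c * Real.exp (-μ * t)) := by gcongr; exact hc t ht
    _ = _ := by ring

lemma congr {μ : ℝ} {f g : ℝ → E} (h : DecaysAt μ f) (hg : ∀ t, 0 ≤ t → g t = f t) :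
    DecaysAt μ g :=
  h.of_le 1 fun t ht => by rw [hg t ht, one_mul]

lemma add {μ : ℝ} {f g : ℝ → E} (hf : DecaysAt μ f) (hg : DecaysAt μ g) :
    DecaysAt μ (fun t => f t + g t) := by
  obtain ⟨c, hc⟩ := hf
  obtain ⟨b, hb⟩ := hg
  refine ⟨c + b, fun t ht => (norm_add_le _ _).trans ?_⟩
  rw [add_mul]
  exact add_le_add (hc t ht) (hb t ht)

lemma neg {μ : ℝ} {f : ℝ → E} (hf : DecaysAt μ f) : DecaysAt μ (fun t => -f t) :=
  hf.of_le 1 fun t _ => by simp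

lemma sub {μ : ℝ} {f g : ℝ → E} (hf : DecaysAt μ f) (hg : DecaysAt μ g) :
    DecaysAt μ (fun t => f t - g t) := by
  simpa only [sub_eq_add_neg] using hf.add hg.neg

lemma map {𝕜 : Type*} [NontriviallyNormedField 𝕜] [NormedSpace 𝕜 E] [NormedSpace 𝕜 F] {μ : ℝ}
    {f : ℝ → E} (h : DecaysAt μ f) (T : E →L[𝕜] F) : DecaysAt μ (fun t => T (f t)) :=
  h.of_le ‖T‖ fun t _ => T.le_opNorm (f t)

lemma zero (μ : ℝ) : DecaysAt μ (fun _ => (0 : E)) := ⟨0, fun t _ => by simp⟩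

lemma pi {ι : Type*} [Fintype ι] {μ : ℝ} {f : ℝ → ι → E} (h : ∀ i, DecaysAt μ (fun t => f t i)) :
    DecaysAt μ f := by
  choose c hc using h
  refine ⟨∑ i, |c i|, fun t ht => ?_⟩
  rw [pi_norm_le_iff_of_nonneg (by positivity)]
  intro i
  refine (hc i t ht).trans ?_
  gcongr
  exact (le_abs_self _).trans
    (Finset.single_le_sum (f := fun i => |c i|) (fun i _ => abs_nonneg _) (Finset.mem_univ i))

end DecaysAt

lemma absolutelyContinuousOnInterval_congr {X : Type*} [PseudoMetricSpace X] {f g : ℝ → X}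
    {a b : ℝ} (hf : AbsolutelyContinuousOnInterval f a b) (h : ∀ x ∈ uIcc a b, f x = g x) :
    AbsolutelyContinuousOnInterval g a b := by
  refine Filter.Tendsto.congr' ?_ hf
  filter_upwards [Filter.mem_inf_of_right (Filter.mem_principal_self _)] with E hE
  refine Finset.sum_congr rfl fun i hi => ?_
  rw [h _ (hE.1 i hi).1, h _ (hE.1 i hi).2]

lemma absolutelyContinuousOnInterval_integral_complex {g : ℝ → ℂ} {T : ℝ}
    (hg : IntervalIntegrable g volume 0 T) :
    AbsolutelyContinuousOnInterval (fun t => ∫ s in (0 : ℝ)..t, g s) 0 T := by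
  have hre : IntervalIntegrable (fun s => (g s).re) volume 0 T :=
    ⟨Complex.reCLM.integrable_comp hg.1, Complex.reCLM.integrable_comp hg.2⟩
  have him : IntervalIntegrable (fun s => (g s).im) volume 0 T :=
    ⟨Complex.imCLM.integrable_comp hg.1, Complex.imCLM.integrable_comp hg.2⟩
  have hconst (c : ℂ) : AbsolutelyContinuousOnInterval (fun _ : ℝ => c) 0 T :=
    (LipschitzWith.const c).lipschitzOnWith.absolutelyContinuousOnInterval
  have h := ((hre.absolutelyContinuousOnInterval_intervalIntegral left_mem_uIcc).fun_smul
    (hconst 1)).fun_add ((him.absolutelyContinuousOnInterval_intervalIntegral left_mem_uIcc).fun_smul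
    (hconst Complex.I))
  refine absolutelyContinuousOnInterval_congr h fun t ht => ?_
  have hsub : IntervalIntegrable g volume 0 t := hg.mono_set (uIcc_subset_uIcc_left ht)
  have h1 := Complex.reCLM.intervalIntegral_comp_comm hsub
  have h2 := Complex.imCLM.intervalIntegral_comp_comm hsub
  simp only [Complex.reCLM_apply, Complex.imCLM_apply] at h1 h2
  rw [h1, h2]
  simp [Complex.re_add_im]

/-- Variation of constants for a scalar equation `f' = a f + g`. -/
lemma HasVelocity.eq_exp_mul {a : ℂ} {f g : ℝ → ℂ} (h : HasVelocity f (fun t => a * f t + g t))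
    {T : ℝ} (hT : 0 ≤ T) :
    f T = Complex.exp (a * T) * (f 0 + ∫ s in (0 : ℝ)..T, Complex.exp (-a * s) * g s) := by
  set w : ℝ → ℂ := fun t => a * f t + g t with hw
  have hwT := h.integrable T hT
  have hfc : ContinuousOn f (uIcc 0 T) :=
    h.continuousOn.mono (by rw [uIcc_of_le hT]; exact Icc_subset_Ici_self)
  have hgT : IntervalIntegrable g volume 0 T := by
    have := hwT.sub ((hfc.const_smul a).intervalIntegrable)
    refine this.congr fun s _ => ?_
    simp [hw]
  have hexp (b : ℂ) (x : ℝ) :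
      HasDerivAt (fun s : ℝ => Complex.exp (b * s)) (Complex.exp (b * x) * b) x := by
    have := ((Complex.ofRealCLM.hasDerivAt (x := x)).const_mul b).cexp
    simpa using this
  have hexpc (b : ℂ) : ContDiff ℝ 1 (fun s : ℝ => Complex.exp (b * s)) :=
    (contDiff_const.mul Complex.ofRealCLM.contDiff).cexp
  have hegT : IntervalIntegrable (fun s : ℝ => Complex.exp (-a * s) * g s) volume 0 T :=
    hgT.continuousOn_mul (hexpc _).continuous.continuousOn
  set φ : ℝ → ℂ := fun t => Complex.exp (-a * t) • (f 0 + ∫ s in (0 : ℝ)..t, w s) -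
    ∫ s in (0 : ℝ)..t, Complex.exp (-a * s) * g s with hφ
  have hac : AbsolutelyContinuousOnInterval φ 0 T := by
    refine AbsolutelyContinuousOnInterval.fun_sub (AbsolutelyContinuousOnInterval.fun_smul ?_
      (AbsolutelyContinuousOnInterval.fun_add (f := fun _ => f 0) ?_
      (absolutelyContinuousOnInterval_integral_complex hwT)))
      (absolutelyContinuousOnInterval_integral_complex hegT)
    · exact (hexpc (-a)).contDiffOn.absolutelyContinuousOnInterval
    · exact (LipschitzWith.const (f 0)).lipschitzOnWith.absolutelyContinuousOnInterval
  have hder : ∀ᵐ x, x ∈ uIcc 0 T → HasDerivAt φ 0 x := by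
    filter_upwards [hwT.ae_hasDerivAt_integral, hegT.ae_hasDerivAt_integral] with x h1 h2 hx
    have hx0 : 0 ≤ x := by rw [uIcc_of_le hT] at hx; exact hx.1
    have := ((hexp (-a) x).smul ((h1 hx 0 left_mem_uIcc).const_add (f 0))).sub
      (h2 hx 0 left_mem_uIcc)
    refine this.congr_deriv ?_
    rw [← h.eq x hx0]
    simp only [hw, smul_eq_mul]
    ring
  obtain ⟨c, hc⟩ := hac.const_of_ae_hasDerivAt_zero hder
  have h0 := hc 0 left_mem_uIcc
  have h1 := hc T right_mem_uIcc
  rw [← h0] at h1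
  simp only [hφ, smul_eq_mul, ← h.eq T hT] at h1
  simp only [intervalIntegral.integral_same, Complex.ofReal_zero, mul_zero, Complex.exp_zero,
    one_mul, sub_zero, add_zero] at h1
  rw [← h1, sub_add_cancel, ← mul_assoc, ← Complex.exp_add]
  simp

lemma HasVelocity.decaysAt {a : ℂ} {f g : ℝ → ℂ} (h : HasVelocity f (fun t => a * f t + g t))
    {μ : ℝ} (ha : a.re < -μ) (hg : DecaysAt μ g) : DecaysAt μ f := by
  obtain ⟨c, hc⟩ := hg
  set β : ℝ := -a.re - μ with hβ
  have hβ0 : 0 < β := by linarith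
  refine ⟨‖f 0‖ + |c| / β, fun t ht => ?_⟩
  have hint : ‖∫ s in (0 : ℝ)..t, Complex.exp (-a * s) * g s‖ ≤ |c| / β * Real.exp (β * t) := by
    have hle : ∀ s ∈ Ioc 0 t, ‖Complex.exp (-a * s) * g s‖ ≤ |c| * Real.exp (β * s) := by
      intro s hs
      rw [norm_mul, Complex.norm_exp]
      have h1 : (-a * (s : ℂ)).re = -a.re * s := by simp
      rw [h1]
      calc Real.exp (-a.re * s) * ‖g s‖ ≤ Real.exp (-a.re * s) * (|c| * Real.exp (-μ * s)) := by
            gcongr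
            exact (hc s hs.1.le).trans (by gcongr; exact le_abs_self c)
        _ = |c| * (Real.exp (-a.re * s) * Real.exp (-μ * s)) := by ring
        _ = |c| * Real.exp (β * s) := by rw [← Real.exp_add]; congr 2; rw [hβ]; ring
    refine (intervalIntegral.norm_integral_le_of_norm_le ht (Filter.Eventually.of_forall hle)
      ((by fun_prop : Continuous fun s : ℝ => |c| * Real.exp (β * s)).intervalIntegrable _ _)).trans
      ?_
    rw [intervalIntegral.integral_const_mul, intervalIntegral.integral_comp_mul_left _ hβ0.ne',
      integral_exp, smul_eq_mul]
    have : Real.exp (β * t) - Real.exp (β * 0) ≤ Real.exp (β * t) := by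
      linarith [Real.exp_pos (β * 0)]
    calc |c| * (β⁻¹ * (Real.exp (β * t) - Real.exp (β * 0)))
        ≤ |c| * (β⁻¹ * Real.exp (β * t)) := by gcongr
      _ = _ := by ring
  rw [h.eq_exp_mul ht, norm_mul, Complex.norm_exp]
  have h1 : (a * (t : ℂ)).re = a.re * t := by simp
  rw [h1]
  have h2 : Real.exp (a.re * t) ≤ Real.exp (-μ * t) := by gcongr
  have h3 : Real.exp (a.re * t) * Real.exp (β * t) = Real.exp (-μ * t) := by
    rw [← Real.exp_add]; congr 1; rw [hβ]; ring
  calc Real.exp (a.re * t) * ‖f 0 + ∫ s in (0 : ℝ)..t, Complex.exp (-a * s) * g s‖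
      ≤ Real.exp (a.re * t) * (‖f 0‖ + |c| / β * Real.exp (β * t)) := by
        gcongr; exact (norm_add_le _ _).trans (by gcongr)
    _ = ‖f 0‖ * Real.exp (a.re * t) + |c| / β * (Real.exp (a.re * t) * Real.exp (β * t)) := by ring
    _ ≤ ‖f 0‖ * Real.exp (-μ * t) + |c| / β * Real.exp (-μ * t) := by rw [h3]; gcongr
    _ = _ := by ring

/-- Let `Φ v`, `v ∈ V`, be signals with `(Φ v)' = Φ (T v) + Γ v`. If `v` is annihilated by a
polynomial in `T` whose roots have real parts below `-μ`, and the inputs `Γ (T ^ k v)` decay at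
rate `μ`, then so does `Φ v`. -/
lemma decaysAt_of_aeval_eq_zero {V : Type*} [AddCommGroup V] [Module ℂ V] (T : Module.End ℂ V)
    (Φ Γ : V →ₗ[ℂ] (ℝ → ℂ)) (hΦ : ∀ v, HasVelocity (Φ v) (fun t => Φ (T v) t + Γ v t))
    {μ : ℝ} {p : ℂ[X]} (hp0 : p ≠ 0) (hp : ∀ z, p.IsRoot z → z.re < -μ) (v : V)
    (hv : Polynomial.aeval T p v = 0) (hΓ : ∀ k : ℕ, DecaysAt μ (Γ ((T ^ k) v))) :
    DecaysAt μ (Φ v) := by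
  have key (s : Multiset ℂ) (hs : ∀ a ∈ s, a.re < -μ) : ∀ v : V,
      Polynomial.aeval T (s.map fun a => Polynomial.X - Polynomial.C a).prod v = 0 →
      (∀ k : ℕ, DecaysAt μ (Γ ((T ^ k) v))) → DecaysAt μ (Φ v) := by
    induction s using Multiset.induction with
    | empty =>
      intro v hv _
      have hv0 : v = 0 := by simpa using hv
      rw [hv0, map_zero]
      exact DecaysAt.zero μ
    | cons a s ih =>
      intro v hv hΓ
      have hv' := ih (fun b hb => hs b (Multiset.mem_cons_of_mem hb)) (T v - a • v) (by
        rw [Multiset.map_cons, Multiset.prod_cons, mul_comm, map_mul] at hv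
        simpa [Module.algebraMap_end_apply] using hv) (fun k => by
        have h1 := hΓ (k + 1)
        have h2 : DecaysAt μ (fun t => a • Γ ((T ^ k) v) t) :=
          (hΓ k).of_le ‖a‖ fun t _ => by rw [norm_smul]
        refine (h1.sub h2).congr fun t _ => ?_
        simp [pow_succ])
      refine HasVelocity.decaysAt (a := a) (g := fun t => Φ (T v - a • v) t + Γ v t)
        ((hΦ v).congr (fun _ _ => rfl) fun t _ => ?_) (hs a (Multiset.mem_cons_self a s))
        (hv'.add (by simpa using hΓ 0))
      simp
      ring
  refine key p.roots (fun a ha => hp a (Polynomial.isRoot_of_mem_roots ha)) v ?_ hΓ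
  rw [(IsAlgClosed.splits p).eq_prod_roots, map_mul, Polynomial.aeval_C] at hv
  simpa [Module.algebraMap_end_apply, hp0] using hv

/-- A real matrix viewed as a complex one. -/
abbrev complexify {m n : Type*} (A : Matrix m n ℝ) : Matrix m n ℂ := A.map (fun a : ℝ => (a : ℂ))

/-- A real vector viewed as a complex one. -/
abbrev complexVec {n : Type*} (x : n → ℝ) : n → ℂ := fun i => (x i : ℂ)

section complexify

variable {l m n : Type*}

lemma complexify_mul [Fintype m] (A : Matrix l m ℝ) (B : Matrix m n ℝ) :
    complexify (A * B) = complexify A * complexify B :=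
  Matrix.map_mul (f := Complex.ofRealHom)

lemma complexify_add (A B : Matrix m n ℝ) : complexify (A + B) = complexify A + complexify B :=
  Matrix.map_add _ Complex.ofReal_add A B

lemma complexify_sub (A B : Matrix m n ℝ) : complexify (A - B) = complexify A - complexify B :=
  Matrix.map_sub _ Complex.ofReal_sub A B

lemma complexify_neg (A : Matrix m n ℝ) : complexify (-A) = -complexify A := by
  ext; simp

lemma complexify_one [DecidableEq n] : complexify (1 : Matrix n n ℝ) = 1 :=
  Matrix.map_one _ Complex.ofReal_zero Complex.ofReal_one

lemma complexify_pow [Fintype n] [DecidableEq n] (A : Matrix n n ℝ) (k : ℕ) :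
    complexify (A ^ k) = complexify A ^ k := by
  induction k with
  | zero => simp
  | succ k ih => rw [pow_succ, complexify_mul, ih, pow_succ]

lemma complexify_injective : Function.Injective (complexify : Matrix m n ℝ → Matrix m n ℂ) :=
  Matrix.map_injective Complex.ofReal_injective

lemma complexVec_mulVec [Fintype n] (A : Matrix m n ℝ) (x : n → ℝ) :
    complexVec (A *ᵥ x) = complexify A *ᵥ complexVec x := by
  ext i
  simp [Matrix.mulVec, dotProduct, complexVec]

end complexify

section Spectrum

variable {ι : Type*} [Fintype ι] [DecidableEq ι]

lemma aeval_charpoly_eq_det (F : Matrix ι ι ℝ) (z : ℂ) :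
    Polynomial.aeval z F.charpoly = (z • (1 : Matrix ι ι ℂ) - complexify F).det := by
  have h : (complexify F).charpoly = F.charpoly.map (algebraMap ℝ ℂ) :=
    Matrix.charpoly_map F (algebraMap ℝ ℂ)
  rw [← Polynomial.eval_map_algebraMap, ← h, Matrix.eval_charpoly, Matrix.smul_one_eq_diagonal]
  rfl

lemma isUnit_det_of_isStablePoly {F : Matrix ι ι ℝ} (hF : IsStablePoly F.charpoly) {s : ℂ}
    (hs : 0 ≤ s.re) : IsUnit (s • (1 : Matrix ι ι ℂ) - complexify F).det := by
  rw [← aeval_charpoly_eq_det, isUnit_iff_ne_zero]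
  exact fun h => absurd (hF s h) (not_lt.2 hs)

/-- A real matrix is Hurwitz iff it has no eigenvector for an eigenvalue in the closed right half
plane. -/
lemma isStablePoly_charpoly_iff {F : Matrix ι ι ℝ} :
    IsStablePoly F.charpoly ↔
      ∀ s : ℂ, 0 ≤ s.re → ∀ v : ι → ℂ, complexify F *ᵥ v = s • v → v = 0 := by
  have key (s : ℂ) (v : ι → ℂ) :
      (s • (1 : Matrix ι ι ℂ) - complexify F) *ᵥ v = 0 ↔ complexify F *ᵥ v = s • v := by
    rw [Matrix.sub_mulVec, Matrix.smul_mulVec, Matrix.one_mulVec, sub_eq_zero, eq_comm]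
  constructor
  · intro hF s hs v hv
    by_contra hv0
    have := Matrix.exists_mulVec_eq_zero_iff.1 ⟨v, hv0, (key s v).2 hv⟩
    exact (isUnit_det_of_isStablePoly hF hs).ne_zero this
  · intro h s hs
    rw [aeval_charpoly_eq_det, ← Matrix.exists_mulVec_eq_zero_iff] at hs
    obtain ⟨v, hv0, hv⟩ := hs
    by_contra hs
    exact hv0 (h s (not_lt.1 hs) v ((key s v).1 hv))

lemma exists_spectral_gap {F : Matrix ι ι ℝ} (hF : IsStablePoly F.charpoly) :
    ∃ μ : ℝ, 0 < μ ∧ ∀ z, (complexify F).charpoly.IsRoot z → z.re < -μ := by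
  have h0 : (complexify F).charpoly ≠ 0 := (Matrix.charpoly_monic _).ne_zero
  have hmap : (complexify F).charpoly = F.charpoly.map (algebraMap ℝ ℂ) :=
    Matrix.charpoly_map F (algebraMap ℝ ℂ)
  have hneg : ∀ z, (complexify F).charpoly.IsRoot z → z.re < 0 := fun z hz =>
    hF z (by rwa [← Polynomial.eval_map_algebraMap, ← hmap])
  have h : ∀ z ∈ (complexify F).charpoly.roots.toFinset, ∀ᶠ μ : ℝ in 𝓝[>] 0, z.re < -μ := by
    intro z hz
    have hz' := hneg z (Polynomial.isRoot_of_mem_roots (Multiset.mem_toFinset.1 hz))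
    have : Filter.Tendsto (fun μ : ℝ => -μ) (𝓝[>] 0) (𝓝 0) := by
      simpa using (continuous_neg.tendsto (0 : ℝ)).mono_left nhdsWithin_le_nhds
    exact this.eventually (lt_mem_nhds hz')
  obtain ⟨μ, hμ, h1⟩ := (((Filter.eventually_all_finset _).2 h).and
    (eventually_mem_nhdsWithin (s := Ioi (0 : ℝ)))).exists
  exact ⟨μ, h1, fun z hz => hμ z (Multiset.mem_toFinset.2 ((Polynomial.mem_roots h0).2 hz))⟩

lemma tendsto_inv_smul_one_sub (F : Matrix ι ι ℂ) :
    Filter.Tendsto (fun s : ℂ => (s • (1 : Matrix ι ι ℂ) - F)⁻¹) (Bornology.cobounded ℂ) (𝓝 0) := by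
  let _ : NormedRing (Matrix ι ι ℂ) := Matrix.linftyOpNormedRing
  let _ : NormedAlgebra ℂ (Matrix ι ι ℂ) := Matrix.linftyOpNormedAlgebra
  refine (spectrum.resolvent_tendsto_cobounded (𝕜 := ℂ) F).congr fun s => ?_
  rw [resolvent, Matrix.nonsing_inv_eq_ringInverse, Algebra.algebraMap_eq_smul_one]

lemma eventually_isUnit_det (F : Matrix ι ι ℂ) :
    ∀ᶠ s in Bornology.cobounded ℂ, IsUnit (s • (1 : Matrix ι ι ℂ) - F).det := by
  let _ : NormedRing (Matrix ι ι ℂ) := Matrix.linftyOpNormedRing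
  let _ : NormedAlgebra ℂ (Matrix ι ι ℂ) := Matrix.linftyOpNormedAlgebra
  filter_upwards [spectrum.eventually_isUnit_resolvent (𝕜 := ℂ) F] with s hs
  rw [spectrum.isUnit_resolvent.symm, spectrum.mem_resolventSet_iff,
    Algebra.algebraMap_eq_smul_one] at hs
  exact (Matrix.isUnit_iff_isUnit_det _).1 hs

end Spectrum

section Functionals

variable {ι : Type*} [Fintype ι]

/-- The complex linear functionals of a real vector signal. -/
def functionalSignal (z : ℝ → ι → ℝ) : (ι → ℂ) →ₗ[ℂ] (ℝ → ℂ) where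
  toFun v t := v ⬝ᵥ complexVec (z t)
  map_add' v w := by ext t; simp [add_dotProduct]
  map_smul' c v := by ext t; simp [smul_dotProduct]

/-- A complex linear functional on real vectors as a continuous real linear map. -/
def functionalCLM (v : ι → ℂ) : (ι → ℝ) →L[ℝ] ℂ :=
  LinearMap.toContinuousLinearMap
    { toFun := fun x => v ⬝ᵥ complexVec x
      map_add' := fun x y => by
        simp [dotProduct, complexVec, mul_add, Finset.sum_add_distrib]
      map_smul' := fun c x => by
        simp [dotProduct, complexVec, Finset.mul_sum]
        exact Finset.sum_congr rfl fun i _ => by ring }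

lemma functionalCLM_apply (v : ι → ℂ) (x : ι → ℝ) : functionalCLM v x = v ⬝ᵥ complexVec x := rfl

lemma functionalSignal_apply (z : ℝ → ι → ℝ) (v : ι → ℂ) (t : ℝ) :
    functionalSignal z v t = v ⬝ᵥ complexVec (z t) := rfl

variable [DecidableEq ι]

lemma hasVelocity_functionalSignal {F : Matrix ι ι ℝ} {z g : ℝ → ι → ℝ}
    (h : HasVelocity z (fun t => F *ᵥ z t + g t)) (v : ι → ℂ) :
    HasVelocity (functionalSignal z v)
      (fun t => functionalSignal z (Matrix.toLin' (complexify F)ᵀ v) t + functionalSignal g v t) := by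
  refine (h.map (functionalCLM v)).congr (fun _ _ => rfl) fun t _ => ?_
  rw [map_add, functionalCLM_apply, functionalCLM_apply, functionalSignal_apply,
    functionalSignal_apply, complexVec_mulVec, Matrix.toLin'_apply, Matrix.mulVec_transpose,
    Matrix.dotProduct_mulVec]

lemma toLin'_pow_row {m : Type*} (F : Matrix ι ι ℝ) (J : Matrix m ι ℝ) (i : m) (k : ℕ)
    (x : ι → ℝ) :
    ((Matrix.toLin' (complexify F)ᵀ) ^ k) (complexVec (J i)) ⬝ᵥ complexVec x =
      (((J * F ^ k) *ᵥ x) i : ℂ) := by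
  rw [← Matrix.toLin'_pow, ← Matrix.transpose_pow, Matrix.toLin'_apply, Matrix.mulVec_transpose,
    ← Matrix.dotProduct_mulVec, ← complexify_pow, ← complexVec_mulVec, ← Matrix.mulVec_mulVec]
  simp [dotProduct, Matrix.mulVec, complexVec]

end Functionals

/-- A Hurwitz system maps inputs decaying at a slow rate `μ` to states decaying at the same rate;
for `μ = 0`, bounded inputs to bounded states. -/
lemma exists_rate {ι : Type*} [Fintype ι] [DecidableEq ι] {F : Matrix ι ι ℝ}
    (hF : IsStablePoly F.charpoly) :
    ∃ μ₀ : ℝ, 0 < μ₀ ∧ ∀ μ ≤ μ₀, ∀ z g : ℝ → ι → ℝ,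
      HasVelocity z (fun t => F *ᵥ z t + g t) → DecaysAt μ g → DecaysAt μ z := by
  obtain ⟨μ₀, h0, hgap⟩ := exists_spectral_gap hF
  refine ⟨μ₀, h0, fun μ hμ z g hz hg => DecaysAt.pi fun i => ?_⟩
  have := decaysAt_of_aeval_eq_zero (Matrix.toLin' (complexify F)ᵀ) (functionalSignal z)
    (functionalSignal g) (hasVelocity_functionalSignal hz) (μ := μ)
    (p := (complexify F).charpoly) (Matrix.charpoly_monic _).ne_zero
    (fun w hw => (hgap w hw).trans_le (by linarith)) (Pi.single i 1) (by
      have := LinearMap.aeval_self_charpoly (Matrix.toLin' (complexify F)ᵀ)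
      rw [Matrix.charpoly_toLin', Matrix.charpoly_transpose] at this
      rw [this, LinearMap.zero_apply])
    (fun k => hg.map (functionalCLM _))
  refine this.of_le 1 fun t _ => ?_
  simp [functionalSignal_apply]

lemma exists_decaysAt_sub {ι κ m q : Type*} [Fintype ι] [DecidableEq ι] [Fintype κ]
    [DecidableEq κ] [Fintype m] [Fintype q] {F₁ : Matrix ι ι ℝ} {F₂ : Matrix κ κ ℝ}
    (hF₁ : IsStablePoly F₁.charpoly) (hF₂ : IsStablePoly F₂.charpoly) {H₁ : Matrix ι q ℝ}
    {H₂ : Matrix κ q ℝ} {J₁ : Matrix m ι ℝ} {J₂ : Matrix m κ ℝ}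
    (hM : ∀ k : ℕ, J₁ * F₁ ^ k * H₁ = J₂ * F₂ ^ k * H₂) {u : ℝ → q → ℝ} {z₁ : ℝ → ι → ℝ}
    {z₂ : ℝ → κ → ℝ} (h₁ : HasVelocity z₁ (fun t => F₁ *ᵥ z₁ t + H₁ *ᵥ u t))
    (h₂ : HasVelocity z₂ (fun t => F₂ *ᵥ z₂ t + H₂ *ᵥ u t)) :
    ∃ μ : ℝ, 0 < μ ∧ DecaysAt μ (fun t => J₁ *ᵥ z₁ t - J₂ *ᵥ z₂ t) := by
  obtain ⟨μ₁, h1, hg1⟩ := exists_spectral_gap hF₁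
  obtain ⟨μ₂, h2, hg2⟩ := exists_spectral_gap hF₂
  refine ⟨min μ₁ μ₂, lt_min h1 h2, DecaysAt.pi fun i => ?_⟩
  set T₁ := Matrix.toLin' (complexify F₁)ᵀ
  set T₂ := Matrix.toLin' (complexify F₂)ᵀ
  have hT₁ : Polynomial.aeval T₁ (complexify F₁).charpoly = 0 := by
    have := LinearMap.aeval_self_charpoly T₁
    rwa [Matrix.charpoly_toLin', Matrix.charpoly_transpose] at this
  have hT₂ : Polynomial.aeval T₂ (complexify F₂).charpoly = 0 := by
    have := LinearMap.aeval_self_charpoly T₂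
    rwa [Matrix.charpoly_toLin', Matrix.charpoly_transpose] at this
  have hpow (k : ℕ) (v : (ι → ℂ) × (κ → ℂ)) :
      ((T₁.prodMap T₂) ^ k) v = ((T₁ ^ k) v.1, (T₂ ^ k) v.2) := by
    induction k generalizing v with
    | zero => rfl
    | succ k ih => simp [pow_succ, ih]
  have haeval (p : ℂ[X]) (v : (ι → ℂ) × (κ → ℂ)) :
      Polynomial.aeval (T₁.prodMap T₂) p v =
        (Polynomial.aeval T₁ p v.1, Polynomial.aeval T₂ p v.2) := by
    have := Polynomial.aeval_algHom_apply (LinearMap.prodMapAlgHom ℂ (ι → ℂ) (κ → ℂ)) (T₁, T₂) p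
    rw [show (LinearMap.prodMapAlgHom ℂ (ι → ℂ) (κ → ℂ)) (T₁, T₂) = T₁.prodMap T₂ from rfl] at this
    rw [this, Polynomial.aeval_prod_apply]
    rfl
  have := decaysAt_of_aeval_eq_zero (T₁.prodMap T₂)
    ((functionalSignal z₁).coprod (functionalSignal z₂))
    ((functionalSignal fun t => H₁ *ᵥ u t).coprod (functionalSignal fun t => H₂ *ᵥ u t))
    (μ := min μ₁ μ₂) (p := (complexify F₁).charpoly * (complexify F₂).charpoly)
    (fun v => ((hasVelocity_functionalSignal h₁ v.1).add
      (hasVelocity_functionalSignal h₂ v.2)).congr (fun _ _ => rfl) fun t _ => by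
        simp only [LinearMap.coprod_apply, LinearMap.prodMap_apply, Pi.add_apply]
        simp only [T₁, T₂]
        ring)
    (mul_ne_zero (Matrix.charpoly_monic _).ne_zero (Matrix.charpoly_monic _).ne_zero)
    (fun w hw => by
      rcases Polynomial.root_mul.1 hw with hw | hw
      · exact (hg1 w hw).trans_le (neg_le_neg (min_le_left _ _))
      · exact (hg2 w hw).trans_le (neg_le_neg (min_le_right _ _)))
    (complexVec (J₁ i), -complexVec (J₂ i))
    (by
      rw [haeval, map_mul, map_mul, hT₁, hT₂]
      simp)
    (fun k => by
      refine (DecaysAt.zero (E := ℂ) _).congr fun t _ => ?_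
      rw [hpow, LinearMap.coprod_apply, Pi.add_apply, functionalSignal_apply,
        functionalSignal_apply, map_neg, neg_dotProduct, toLin'_pow_row, toLin'_pow_row,
        Matrix.mulVec_mulVec, Matrix.mulVec_mulVec, hM, add_neg_cancel])
  refine this.of_le 1 fun t _ => ?_
  rw [LinearMap.coprod_apply, Pi.add_apply, functionalSignal_apply, functionalSignal_apply,
    neg_dotProduct]
  have e1 := toLin'_pow_row F₁ J₁ i 0 (z₁ t)
  have e2 := toLin'_pow_row F₂ J₂ i 0 (z₂ t)
  simp only [pow_zero, Matrix.mul_one, Module.End.one_apply] at e1 e2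
  rw [e1, e2, ← sub_eq_add_neg, ← Complex.ofReal_sub, Complex.norm_real, one_mul]
  rfl

/-- Systems whose transfer matrices agree on the closed right half plane have the same Markov
parameters. -/
lemma markov_eq_of_transferMatrix_eq {k₁ k₂ : ℕ} {m q : Type*} {F₁ : Matrix (Fin k₁) (Fin k₁) ℝ}
    {F₂ : Matrix (Fin k₂) (Fin k₂) ℝ} {H₁ : Matrix (Fin k₁) q ℝ}
    {H₂ : Matrix (Fin k₂) q ℝ} {J₁ : Matrix m (Fin k₁) ℝ} {J₂ : Matrix m (Fin k₂) ℝ}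
    (h : ∀ s : ℂ, 0 ≤ s.re → transferMatrix F₁ H₁ J₁ s = transferMatrix F₂ H₂ J₂ s) (k : ℕ) :
    J₁ * F₁ ^ k * H₁ = J₂ * F₂ ^ k * H₂ := by
  have hcob : Filter.Tendsto (fun t : ℝ => (t : ℂ)) Filter.atTop (Bornology.cobounded ℂ) := by
    rw [← tendsto_norm_atTop_iff_cobounded]
    simpa using Filter.tendsto_abs_atTop_atTop
  have hunit {l : ℕ} (F : Matrix (Fin l) (Fin l) ℝ) :
      ∀ᶠ t : ℝ in Filter.atTop, IsUnit ((t : ℂ) • (1 : Matrix (Fin l) (Fin l) ℂ) -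
        complexify F).det := hcob.eventually (eventually_isUnit_det _)
  have hstep {l : ℕ} (F : Matrix (Fin l) (Fin l) ℝ) (H : Matrix (Fin l) q ℝ)
      (J : Matrix m (Fin l) ℝ) (k : ℕ) {s : ℂ}
      (hs : IsUnit (s • (1 : Matrix (Fin l) (Fin l) ℂ) - complexify F).det) :
      s • transferMatrix F H (J * F ^ k) s =
        complexify (J * F ^ k * H) + transferMatrix F H (J * F ^ (k + 1)) s := by
    have h1 : s • (s • (1 : Matrix (Fin l) (Fin l) ℂ) - complexify F)⁻¹ =
        1 + complexify F * (s • (1 : Matrix (Fin l) (Fin l) ℂ) - complexify F)⁻¹ := by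
      have := Matrix.mul_nonsing_inv _ hs
      rw [Matrix.sub_mul, Matrix.smul_mul, Matrix.one_mul, sub_eq_iff_eq_add] at this
      exact this
    have h2 : s • transferMatrix F H (J * F ^ k) s = complexify (J * F ^ k) *
        (s • (s • (1 : Matrix (Fin l) (Fin l) ℂ) - complexify F)⁻¹) * complexify H := by
      simp [transferMatrix]
    have h3 : transferMatrix F H (J * F ^ (k + 1)) s = complexify (J * F ^ k) * complexify F *
        (s • (1 : Matrix (Fin l) (Fin l) ℂ) - complexify F)⁻¹ * complexify H := by
      rw [transferMatrix, pow_succ, ← Matrix.mul_assoc, ← complexify_mul]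
    rw [h2, h1, h3, complexify_mul (J * F ^ k) H]
    simp only [Matrix.mul_add, Matrix.add_mul, Matrix.mul_one, Matrix.mul_assoc]
  have hlim {l : ℕ} (F : Matrix (Fin l) (Fin l) ℝ) (H : Matrix (Fin l) q ℝ)
      (J : Matrix m (Fin l) ℝ) :
      Filter.Tendsto (fun t : ℝ => transferMatrix F H J t) Filter.atTop (𝓝 0) := by
    have h1 := (tendsto_inv_smul_one_sub (complexify F)).comp hcob
    have h2 : Continuous fun N : Matrix (Fin l) (Fin l) ℂ => complexify J * N * complexify H := by
      fun_prop
    have h3 := (h2.tendsto 0).comp h1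
    rw [Matrix.mul_zero, Matrix.zero_mul] at h3
    exact h3
  have key (k : ℕ) : J₁ * F₁ ^ k * H₁ = J₂ * F₂ ^ k * H₂ ∧ ∀ᶠ t : ℝ in Filter.atTop,
      transferMatrix F₁ H₁ (J₁ * F₁ ^ (k + 1)) t = transferMatrix F₂ H₂ (J₂ * F₂ ^ (k + 1)) t := by
    have step (k : ℕ) (hk : ∀ᶠ t : ℝ in Filter.atTop,
        transferMatrix F₁ H₁ (J₁ * F₁ ^ k) t = transferMatrix F₂ H₂ (J₂ * F₂ ^ k) t) :
        J₁ * F₁ ^ k * H₁ = J₂ * F₂ ^ k * H₂ ∧ ∀ᶠ t : ℝ in Filter.atTop,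
        transferMatrix F₁ H₁ (J₁ * F₁ ^ (k + 1)) t =
          transferMatrix F₂ H₂ (J₂ * F₂ ^ (k + 1)) t := by
      have heq : ∀ᶠ t : ℝ in Filter.atTop,
          complexify (J₁ * F₁ ^ k * H₁) + transferMatrix F₁ H₁ (J₁ * F₁ ^ (k + 1)) t =
          complexify (J₂ * F₂ ^ k * H₂) + transferMatrix F₂ H₂ (J₂ * F₂ ^ (k + 1)) t := by
        filter_upwards [hk, hunit F₁, hunit F₂] with t h1 h2 h3
        rw [← hstep F₁ H₁ J₁ k h2, ← hstep F₂ H₂ J₂ k h3, h1]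
      have hD : J₁ * F₁ ^ k * H₁ = J₂ * F₂ ^ k * H₂ := by
        apply complexify_injective
        have l1 := (hlim F₁ H₁ (J₁ * F₁ ^ (k + 1))).const_add (complexify (J₁ * F₁ ^ k * H₁))
        have l2 := (hlim F₂ H₂ (J₂ * F₂ ^ (k + 1))).const_add (complexify (J₂ * F₂ ^ k * H₂))
        rw [add_zero] at l1 l2
        exact tendsto_nhds_unique (l1.congr' heq) l2
      refine ⟨hD, ?_⟩
      filter_upwards [heq] with t ht
      rw [hD] at ht
      exact add_left_cancel ht
    induction k with
    | zero =>
      refine step 0 ?_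
      filter_upwards [Filter.eventually_ge_atTop 0] with t ht
      simpa using h t (by simpa using ht)
    | succ k ih => exact step (k + 1) ih.2
  exact (key k).1

lemma IsTrajectory.hasVelocity {k : ℕ} {q : Type*} [Fintype q] {A : Matrix (Fin k) (Fin k) ℝ}
    {B : Matrix (Fin k) q ℝ} {u : ℝ → q → ℝ} {x : ℝ → Fin k → ℝ} (h : IsTrajectory A B u x) :
    HasVelocity x (fun t => A *ᵥ x t + B *ᵥ u t) := by
  refine ⟨fun t ht => ?_, h.continuousOn, h.eq⟩
  refine IntervalIntegrable.add ?_ ?_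
  · refine ContinuousOn.intervalIntegrable ?_
    have : Continuous fun v : Fin k → ℝ => A *ᵥ v := by fun_prop
    refine this.comp_continuousOn (h.continuousOn.mono ?_)
    rw [uIcc_of_le ht]
    exact Icc_subset_Ici_self
  · have hB := h.input_integrable t ht
    let T := (Matrix.mulVecLin B).toContinuousLinearMap
    exact ⟨T.integrable_comp hB.1, T.integrable_comp hB.2⟩

/-- Two outputs of the same stable filter with the same input differ by a decaying term. -/
lemma IsResponse.exists_decaysAt_sub {p q : Type*} [Fintype p] [Fintype q] {W : ℂ → Matrix p q ℂ}
    {u : ℝ → q → ℝ} {y y' : ℝ → p → ℝ} (h : IsResponse W u y) (h' : IsResponse W u y') :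
    ∃ μ : ℝ, 0 < μ ∧ DecaysAt μ (fun t => y t - y' t) := by
  obtain ⟨k, F, H, J, z, hF, hW, hz, hy⟩ := h
  obtain ⟨k', F', H', J', z', hF', hW', hz', hy'⟩ := h'
  obtain ⟨μ, hμ, hd⟩ := PartialStateMRC.exists_decaysAt_sub hF hF'
    (markov_eq_of_transferMatrix_eq fun s hs => (hW s hs).trans (hW' s hs).symm)
    hz.hasVelocity hz'.hasVelocity
  exact ⟨μ, hμ, hd.congr fun t ht => by rw [hy t ht, hy' t ht]⟩

lemma IsResponse.isBounded {p q : Type*} [Fintype p] [Fintype q] {W : ℂ → Matrix p q ℂ}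
    {u : ℝ → q → ℝ} {y : ℝ → p → ℝ} (h : IsResponse W u y) (hu : DecaysAt 0 u) :
    DecaysAt 0 y := by
  obtain ⟨k, F, H, J, z, hF, hW, hz, hy⟩ := h
  obtain ⟨μ, hμ, hd⟩ := exists_rate hF
  have := hd 0 hμ.le z _ hz.hasVelocity (hu.map (Matrix.mulVecLin H).toContinuousLinearMap)
  exact (this.map (Matrix.mulVecLin J).toContinuousLinearMap).congr fun t ht => hy t ht

/-- A stable system given over an arbitrary finite index type provides a response. -/
lemma isResponse_of_hasVelocity {ι p q : Type*} [Fintype ι] [DecidableEq ι] [Fintype q]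
    {F : Matrix ι ι ℝ} {H : Matrix ι q ℝ} {J : Matrix p ι ℝ} {W : ℂ → Matrix p q ℂ}
    (hF : IsStablePoly F.charpoly)
    (hW : ∀ s : ℂ, 0 ≤ s.re → ∃ X : Matrix ι q ℂ,
      (s • (1 : Matrix ι ι ℂ) - complexify F) * X = complexify H ∧ complexify J * X = W s)
    {u : ℝ → q → ℝ} {z : ℝ → ι → ℝ} (hu : ∀ t, 0 ≤ t → IntervalIntegrable u volume 0 t)
    (hz : HasVelocity z (fun t => F *ᵥ z t + H *ᵥ u t)) :
    IsResponse W u (fun t => J *ᵥ z t) := by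
  let e := Fintype.equivFin ι
  refine ⟨Fintype.card ι, F.submatrix e.symm e.symm, H.submatrix e.symm id,
    J.submatrix id e.symm, fun t i => z t (e.symm i), ?_, fun s hs => ?_, ⟨hu, ?_, ?_⟩, ?_⟩
  · have : (F.submatrix e.symm e.symm).charpoly = F.charpoly := Matrix.charpoly_reindex e F
    rw [IsHurwitz, this]
    exact hF
  · obtain ⟨X, hX, hJ⟩ := hW s hs
    have h1 : s • (1 : Matrix (Fin (Fintype.card ι)) (Fin (Fintype.card ι)) ℂ) -
        complexify (F.submatrix e.symm e.symm) =
        (s • (1 : Matrix ι ι ℂ) - complexify F).submatrix e.symm e.symm := by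
      ext i j
      simp [Matrix.one_apply]
    have h2 : (s • (1 : Matrix ι ι ℂ) - complexify F)⁻¹ * complexify H = X := by
      rw [← hX, Matrix.nonsing_inv_mul_cancel_left _ _ (isUnit_det_of_isStablePoly hF hs)]
    have h3 : complexify (J.submatrix id e.symm) = (complexify J).submatrix id e.symm := rfl
    have h4 : complexify (H.submatrix e.symm id) = (complexify H).submatrix e.symm id := rfl
    change complexify (J.submatrix id e.symm) * (_ - complexify (F.submatrix e.symm e.symm))⁻¹ *
      complexify (H.submatrix e.symm id) = W s
    rw [h1, h3, h4, Matrix.inv_submatrix_equiv, Matrix.submatrix_mul_equiv,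
      Matrix.submatrix_mul_equiv, Matrix.mul_assoc, h2, hJ, Matrix.submatrix_id_id]
  · exact continuousOn_pi.2 fun i => (continuousOn_pi.1 hz.continuousOn) (e.symm i)
  · let T : (ι → ℝ) →L[ℝ] (Fin (Fintype.card ι) → ℝ) :=
      (LinearMap.funLeft ℝ ℝ e.symm).toContinuousLinearMap
    intro t ht
    refine ((hz.map T).eq t ht).trans ?_
    congr 1
    refine intervalIntegral.integral_congr fun τ _ => ?_
    ext i
    change (F *ᵥ z τ) (e.symm i) + (H *ᵥ u τ) (e.symm i) = _
    rw [Pi.add_apply]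
    congr 1
    simp only [Matrix.mulVec, dotProduct, Matrix.submatrix_apply]
    exact (Equiv.sum_comp e.symm fun j => F (e.symm i) j * z τ j).symm
  · intro t ht
    ext i
    simp only [Matrix.mulVec, dotProduct, Matrix.submatrix_apply, id]
    exact (Equiv.sum_comp e.symm fun j => J i j * z t j).symm

/-- Existence of Carathéodory solutions of linear equations with a locally integrable input. -/
lemma exists_hasVelocity {E : Type*} [NormedAddCommGroup E] [NormedSpace ℝ E] [CompleteSpace E]
    (L : E →L[ℝ] E) {g : ℝ → E} (hg : ∀ t, 0 ≤ t → IntervalIntegrable g volume 0 t) (z₀ : E) :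
    ∃ z : ℝ → E, z 0 = z₀ ∧ HasVelocity z (fun t => L (z t) + g t) := by
  set g' : ℝ → E := (Ioi 0).indicator g with hg'
  have hgg' {t : ℝ} (ht : 0 < t) : g' t = g t := indicator_of_mem ht g
  have hint (t : ℝ) : IntervalIntegrable g' volume 0 t := by
    rcases le_total 0 t with ht | ht
    · refine (hg t ht).congr fun s hs => ?_
      rw [uIoc_of_le ht] at hs
      exact (hgg' hs.1).symm
    · refine (intervalIntegrable_const (c := (0 : E))).congr fun s hs => ?_
      rw [uIoc_of_ge ht] at hs
      exact (indicator_of_notMem (by simpa using hs.2) g).symm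
  set G : ℝ → E := fun t => ∫ s in (0 : ℝ)..t, g' s with hG
  have hGc : Continuous G :=
    intervalIntegral.continuous_primitive (fun a b => (hint a).symm.trans (hint b)) 0
  have hexp (c : ℝ) (t : ℝ) : HasDerivAt (fun s : ℝ => NormedSpace.exp ((c * s) • L))
      (c • (NormedSpace.exp ((c * t) • L) * L)) t := by
    have h1 : HasDerivAt (fun s : ℝ => c * s) c t := by
      simpa using (hasDerivAt_id t).const_mul c
    exact (hasDerivAt_exp_smul_const (𝕂 := ℝ) L (c * t)).scomp t h1
  have hexpc (c : ℝ) : Continuous (fun s : ℝ => NormedSpace.exp ((c * s) • L)) :=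
    continuous_iff_continuousAt.2 fun t => (hexp c t).continuousAt
  set I : ℝ → E := fun t => ∫ s in (0 : ℝ)..t, NormedSpace.exp ((-1 * s) • L) (L (G s)) with hI
  have hIc : Continuous fun s : ℝ => NormedSpace.exp ((-1 * s) • L) (L (G s)) :=
    (hexpc _).clm_apply (L.continuous.comp hGc)
  have hId (t : ℝ) : HasDerivAt I (NormedSpace.exp ((-1 * t) • L) (L (G t))) t :=
    intervalIntegral.integral_hasDerivAt_right (hIc.intervalIntegrable _ _)
      (hIc.stronglyMeasurableAtFilter _ _) hIc.continuousAt
  set Y : ℝ → E := fun t => NormedSpace.exp ((1 * t) • L) (z₀ + I t) with hY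
  have hYd (t : ℝ) : HasDerivAt Y (L (Y t) + L (G t)) t := by
    refine ((hexp 1 t).clm_apply ((hId t).const_add z₀)).congr_deriv ?_
    let _ : NormedAlgebra ℚ (E →L[ℝ] E) := NormedAlgebra.restrictScalars ℚ ℝ _
    have hcomm : NormedSpace.exp ((1 * t) • L) * L = L * NormedSpace.exp ((1 * t) • L) :=
      (((Commute.refl L).smul_left (1 * t)).exp_left).eq
    have hinv : NormedSpace.exp ((1 * t) • L) * NormedSpace.exp ((-1 * t) • L) = 1 := by
      rw [← NormedSpace.exp_add_of_commute (((Commute.refl L).smul_left _).smul_right _),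
        ← add_smul]
      simp
    rw [one_smul, hcomm]
    congr 1
    exact congrArg (fun N : E →L[ℝ] E => N (L (G t))) hinv
  have hYc : Continuous Y := continuous_iff_continuousAt.2 fun t => (hYd t).continuousAt
  have hLc : Continuous fun t => L (Y t) + L (G t) :=
    (L.continuous.comp hYc).add (L.continuous.comp hGc)
  have hG0 : G 0 = 0 := intervalIntegral.integral_same
  refine ⟨fun t => Y t + G t, ?_, ?_⟩
  · simp [hY, hI, hG0]
  · have h1 : HasVelocity Y (fun t => L (Y t) + L (G t)) :=
      ⟨fun t _ => hLc.intervalIntegrable _ _, hYc.continuousOn, fun t _ => by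
        rw [intervalIntegral.integral_eq_sub_of_hasDerivAt (fun s _ => hYd s)
          (hLc.intervalIntegrable _ _), add_sub_cancel]⟩
    have h2 : HasVelocity G g := by
      refine ⟨hg, hGc.continuousOn, fun t ht => ?_⟩
      rw [hG0, zero_add]
      refine intervalIntegral.integral_congr_uIoo fun s hs => ?_
      rw [uIoo_of_le ht] at hs
      exact hgg' hs.1
    exact (h1.add h2).congr (fun _ _ => rfl) fun t _ => by rw [map_add]

/-- Right division of a polynomial matrix by `X - A`. -/
lemma exists_eval_eq_mul_sub_add {m n : Type*} [Fintype m] [Fintype n] [DecidableEq n]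
    (A : Matrix n n ℝ) (p : Matrix m n ℝ[X]) :
    ∃ (P : Matrix m n ℝ[X]) (Q : Matrix m n ℝ), ∀ s : ℂ,
      p.map (Polynomial.aeval s) =
        P.map (Polynomial.aeval s) * (s • (1 : Matrix n n ℂ) - complexify A) + complexify Q := by
  have key (N : ℕ) : ∀ p : Matrix m n ℝ[X], (∀ i j, (p i j).natDegree ≤ N) →
      ∃ (P : Matrix m n ℝ[X]) (Q : Matrix m n ℝ), ∀ s : ℂ,
        p.map (Polynomial.aeval s) =
          P.map (Polynomial.aeval s) * (s • (1 : Matrix n n ℂ) - complexify A) + complexify Q := by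
    induction N with
    | zero =>
      intro p hp
      refine ⟨0, p.map fun q => q.coeff 0, fun s => ?_⟩
      ext i j
      have := Polynomial.eq_C_of_natDegree_le_zero (hp i j)
      rw [Matrix.map_apply, this]
      simp [Matrix.zero_mul]
    | succ N ih =>
      intro p hp
      obtain ⟨P, Q, hPQ⟩ := ih (p.map Polynomial.divX) (fun i j => by
        rw [Matrix.map_apply, Polynomial.natDegree_divX_eq_natDegree_tsub_one]
        have := hp i j
        omega)
      refine ⟨(Polynomial.X : ℝ[X]) • P + Q.map Polynomial.C,
        Q * A + p.map fun q => q.coeff 0, fun s => ?_⟩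
      have h1 : p.map (Polynomial.aeval s) = s • (p.map Polynomial.divX).map (Polynomial.aeval s) +
          complexify (p.map fun q => q.coeff 0) := by
        ext i j
        have := congrArg (Polynomial.aeval s) (Polynomial.X_mul_divX_add (p i j))
        rw [map_add, map_mul, Polynomial.aeval_X, Polynomial.aeval_C] at this
        simpa using this.symm
      have h2 : ((Polynomial.X : ℝ[X]) • P + Q.map Polynomial.C).map (Polynomial.aeval s) =
          s • P.map (Polynomial.aeval s) + complexify Q := by
        ext i j
        simp
      rw [h1, hPQ, h2, complexify_add, complexify_mul]
      simp only [Matrix.add_mul, Matrix.mul_sub, Matrix.smul_mul, Matrix.mul_smul, smul_add,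
        Matrix.mul_one, smul_sub]
      abel
  exact key (Finset.univ.sup fun i => Finset.univ.sup fun j => (p i j).natDegree) p fun i j =>
    (Finset.le_sup (f := fun j => (p i j).natDegree) (Finset.mem_univ j)).trans
      (Finset.le_sup (f := fun i => Finset.univ.sup fun j => (p i j).natDegree) (Finset.mem_univ i))

lemma aeval_eq_of_tendsto_cobounded {p : ℝ[X]} {L : ℂ}
    (h : Filter.Tendsto (fun s : ℂ => Polynomial.aeval s p) (Bornology.cobounded ℂ) (𝓝 L)) (s : ℂ) :
    Polynomial.aeval s p = L := by
  have hdeg : ¬ 0 < (p.map (algebraMap ℝ ℂ)).degree := by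
    intro hd
    have := Polynomial.tendsto_norm_atTop (p.map (algebraMap ℝ ℂ)) hd
      (tendsto_norm_cobounded_atTop (E := ℂ))
    simp only [Polynomial.eval_map_algebraMap] at this
    exact not_tendsto_nhds_of_tendsto_atTop this _ h.norm
  rw [Polynomial.degree_map, not_lt] at hdeg
  rw [Polynomial.eq_C_of_degree_le_zero hdeg] at h ⊢
  simp only [Polynomial.aeval_C] at h ⊢
  exact tendsto_nhds_unique tendsto_const_nhds h

section

variable {n M : ℕ} {A : Matrix (Fin n) (Fin n) ℝ} {B : Matrix (Fin n) (Fin M) ℝ}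
  {C : Matrix (Fin M) (Fin n) ℝ} {ξ : Matrix (Fin M) (Fin M) ℝ[X]}

lemma IsModifiedLeftInteractor.isUnit_det {G : ℂ → Matrix (Fin M) (Fin M) ℂ}
    (hξ : IsModifiedLeftInteractor ξ G) {s : ℂ} (hs : 0 ≤ s.re) :
    IsUnit (evalPolyMatrix ξ s).det := by
  rw [Matrix.det_of_isLowerTriangular, isUnit_iff_ne_zero, Finset.prod_ne_zero_iff]
  · exact fun i _ h => absurd (hξ.stable i s h) (not_lt.2 hs)
  · intro i j hij
    simp [evalPolyMatrix, hξ.lower i j hij]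

/-- State feedback that assigns the closed loop transfer matrix `ξ⁻¹ K_p`. -/
lemma IsModifiedLeftInteractor.exists_feedback
    (hξ : IsModifiedLeftInteractor ξ (transferMatrix A B C)) :
    ∃ (Kp : Matrix (Fin M) (Fin M) ℝ) (K : Matrix (Fin M) (Fin n) ℝ)
      (P : ℂ → Matrix (Fin M) (Fin n) ℂ), Kp.det ≠ 0 ∧ ∀ s : ℂ,
      evalPolyMatrix ξ s * complexify C =
        P s * (s • (1 : Matrix (Fin n) (Fin n) ℂ) - complexify (A + B * K)) ∧
      P s * complexify B = complexify Kp := by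
  obtain ⟨Kp, hKp, hlim⟩ := hξ.gain
  obtain ⟨P, Q, hPQ⟩ := exists_eval_eq_mul_sub_add A (ξ * C.map Polynomial.C)
  have hev (s : ℂ) : (ξ * C.map Polynomial.C).map (Polynomial.aeval s) =
      evalPolyMatrix ξ s * complexify C := by
    ext i j
    simp [Matrix.mul_apply, evalPolyMatrix]
  have hPB (s : ℂ) : P.map (Polynomial.aeval s) * complexify B =
      (P * B.map Polynomial.C).map (Polynomial.aeval s) := by
    ext i j
    simp [Matrix.mul_apply]
  have hconst (s : ℂ) : P.map (Polynomial.aeval s) * complexify B = complexify Kp := by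
    have hcont : Continuous fun N : Matrix (Fin n) (Fin n) ℂ =>
        complexify Q * N * complexify B := by fun_prop
    have h1 := (hcont.tendsto 0).comp (tendsto_inv_smul_one_sub (complexify A))
    rw [Matrix.mul_zero, Matrix.zero_mul] at h1
    have h2 := hlim.sub h1
    rw [sub_zero] at h2
    have h3 : Filter.Tendsto (fun s : ℂ => P.map (Polynomial.aeval s) * complexify B)
        (Bornology.cobounded ℂ) (𝓝 (complexify Kp)) := by
      refine h2.congr' ?_
      filter_upwards [eventually_isUnit_det (complexify A)] with s hs
      have e1 : evalPolyMatrix ξ s * transferMatrix A B C s = evalPolyMatrix ξ s * complexify C *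
          (s • (1 : Matrix (Fin n) (Fin n) ℂ) - complexify A)⁻¹ * complexify B := by
        simp only [transferMatrix, Matrix.mul_assoc]
      rw [e1, ← hev, hPQ, Function.comp_apply, Matrix.add_mul, Matrix.add_mul,
        Matrix.mul_nonsing_inv_cancel_right _ _ hs, add_sub_cancel_right]
    ext i j
    rw [hPB]
    have h4 : Filter.Tendsto (fun s : ℂ => Polynomial.aeval s ((P * B.map Polynomial.C) i j))
        (Bornology.cobounded ℂ) (𝓝 (complexify Kp i j)) := by
      have := (tendsto_pi_nhds.1 (tendsto_pi_nhds.1 h3 i)) j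
      simp only [hPB] at this
      exact this
    exact aeval_eq_of_tendsto_cobounded h4 s
  refine ⟨Kp, -(Kp⁻¹ * Q), fun s => P.map (Polynomial.aeval s), hKp, fun s => ⟨?_, hconst s⟩⟩
  rw [← hev, hPQ, complexify_add, complexify_mul, ← sub_sub, Matrix.mul_sub _ _ (_ * _),
    ← Matrix.mul_assoc, hconst, ← complexify_mul, Matrix.mul_neg,
    Matrix.mul_nonsing_inv_cancel_left _ _ (isUnit_iff_ne_zero.2 hKp), complexify_neg,
    sub_neg_eq_add]

lemma analyticAt_inv_smul_one_sub {F : Matrix (Fin n) (Fin n) ℂ} {z : ℂ}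
    (hz : IsUnit (z • (1 : Matrix (Fin n) (Fin n) ℂ) - F).det) (b : Fin n → ℂ) :
    AnalyticAt ℂ (fun s => (s • (1 : Matrix (Fin n) (Fin n) ℂ) - F)⁻¹ *ᵥ b) z := by
  let _ : NormedRing (Matrix (Fin n) (Fin n) ℂ) := Matrix.linftyOpNormedRing
  let _ : NormedAlgebra ℂ (Matrix (Fin n) (Fin n) ℂ) := Matrix.linftyOpNormedAlgebra
  obtain ⟨U, hU⟩ := (Matrix.isUnit_iff_isUnit_det _).2 hz
  have h1 : AnalyticAt ℂ (fun s : ℂ => s • (1 : Matrix (Fin n) (Fin n) ℂ) - F) z :=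
    (analyticAt_id.smul analyticAt_const).sub analyticAt_const
  have h2 : AnalyticAt ℂ (Ring.inverse : Matrix (Fin n) (Fin n) ℂ → _)
      (z • (1 : Matrix (Fin n) (Fin n) ℂ) - F) := by
    rw [← hU]
    exact analyticAt_inverse U
  let L : Matrix (Fin n) (Fin n) ℂ →L[ℂ] (Fin n → ℂ) := LinearMap.toContinuousLinearMap
    { toFun := fun N => N *ᵥ b
      map_add' := fun N N' => Matrix.add_mulVec N N' b
      map_smul' := fun c N => Matrix.smul_mulVec c N b }
  have h3 := (L.analyticAt _).comp
    (h2.comp (f := fun s : ℂ => s • (1 : Matrix (Fin n) (Fin n) ℂ) - F) (x := z) h1)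
  refine h3.congr (Filter.Eventually.of_forall fun s => ?_)
  simp only [Function.comp_apply, Matrix.nonsing_inv_eq_ringInverse]
  rfl

lemma eventually_nhdsNE_isUnit_det (F : Matrix (Fin n) (Fin n) ℂ) (z : ℂ) :
    ∀ᶠ s in 𝓝[≠] z, IsUnit (s • (1 : Matrix (Fin n) (Fin n) ℂ) - F).det := by
  have hfin : {s : ℂ | F.charpoly.IsRoot s}.Finite :=
    Polynomial.finite_setOfPred_isRoot (Matrix.charpoly_monic F).ne_zero
  have : ∀ᶠ s in 𝓝[≠] z, s ∉ {s : ℂ | F.charpoly.IsRoot s} :=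
    nhdsNE_le_cofinite z hfin.compl_mem_cofinite
  filter_upwards [this] with s hs
  rw [isUnit_iff_ne_zero]
  intro h
  apply hs
  rw [Polynomial.IsRoot.def, Matrix.eval_charpoly, ← h, Matrix.smul_one_eq_diagonal]
  rfl

/-- A direction `w` and state `v` on which the system pencil `[z - A, -B; C, 0]` is singular at
a point `z` of the closed right half plane give a transmission zero. -/
lemma isTransmissionZero_of_pencil (hstab : IsStabilizable A B) {z : ℂ} (hz : 0 ≤ z.re)
    {v : Fin n → ℂ} {w : Fin M → ℂ} (hw : w ≠ 0)
    (h : (z • (1 : Matrix (Fin n) (Fin n) ℂ) - complexify A) *ᵥ v = complexify B *ᵥ w)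
    (hC : complexify C *ᵥ v = 0) : IsTransmissionZero (transferMatrix A B C) z := by
  obtain ⟨K, hK⟩ := hstab
  have hu := isUnit_det_of_isStablePoly hK hz
  set w' : Fin M → ℂ := w - complexify K *ᵥ v with hw'
  set ρ : ℂ → Fin n → ℂ := fun s =>
    (s • (1 : Matrix (Fin n) (Fin n) ℂ) - complexify (A + B * K))⁻¹ *ᵥ (complexify B *ᵥ w') with hρ
  have hρa : AnalyticAt ℂ ρ z := analyticAt_inv_smul_one_sub hu _
  have hsplit (s : ℂ) (x : Fin n → ℂ) :
      (s • (1 : Matrix (Fin n) (Fin n) ℂ) - complexify A) *ᵥ x =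
        (s • (1 : Matrix (Fin n) (Fin n) ℂ) - complexify (A + B * K)) *ᵥ x +
          complexify B *ᵥ (complexify K *ᵥ x) := by
    rw [complexify_add, complexify_mul, ← sub_sub, Matrix.sub_mulVec _ (complexify B * complexify K),
      ← Matrix.mulVec_mulVec, sub_add_cancel]
  have hρz : ρ z = v := by
    have : (z • (1 : Matrix (Fin n) (Fin n) ℂ) - complexify (A + B * K)) *ᵥ v =
        complexify B *ᵥ w' := by
      rw [hw', Matrix.mulVec_sub, ← h, hsplit, add_sub_cancel_right]
    simp only [hρ]
    rw [← this, Matrix.mulVec_mulVec, Matrix.nonsing_inv_mul _ hu, Matrix.one_mulVec]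
  have hlin (s : ℂ) (hs : IsUnit (s • (1 : Matrix (Fin n) (Fin n) ℂ) - complexify A).det)
      (hs' : IsUnit (s • (1 : Matrix (Fin n) (Fin n) ℂ) - complexify (A + B * K)).det) :
      transferMatrix A B C s *ᵥ (w' + complexify K *ᵥ ρ s) = complexify C *ᵥ ρ s := by
    have h1 : complexify B *ᵥ (w' + complexify K *ᵥ ρ s) =
        (s • (1 : Matrix (Fin n) (Fin n) ℂ) - complexify A) *ᵥ ρ s := by
      rw [hsplit, Matrix.mulVec_add]
      congr 1
      simp only [hρ]
      rw [Matrix.mulVec_mulVec, Matrix.mul_nonsing_inv _ hs', Matrix.one_mulVec]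
    rw [transferMatrix, ← Matrix.mulVec_mulVec, h1, Matrix.mulVec_mulVec,
      Matrix.nonsing_inv_mul_cancel_right _ _ hs]
  refine ⟨fun s => w' + complexify K *ᵥ ρ s, ?_, ?_, ?_⟩
  · exact analyticAt_const.add
      (((Matrix.mulVecLin (complexify K)).toContinuousLinearMap.analyticAt _).comp hρa)
  · simpa [hρz, hw'] using hw
  · have h1 : Filter.Tendsto (fun s => complexify C *ᵥ ρ s) (𝓝[≠] z) (𝓝 0) := by
      have hc : Continuous fun x : Fin n → ℂ => complexify C *ᵥ x := by fun_prop
      have := ((hc.tendsto _).comp hρa.continuousAt.tendsto).mono_left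
        (nhdsWithin_le_nhds (s := {z}ᶜ))
      rwa [hρz, hC] at this
    refine h1.congr' ?_
    filter_upwards [eventually_nhdsNE_isUnit_det (complexify A) z,
      eventually_nhdsNE_isUnit_det (complexify (A + B * K)) z] with s h1 h2
    exact (hlin s h1 h2).symm

lemma isHurwitz_of_feedback {K : Matrix (Fin M) (Fin n) ℝ} {P : ℂ → Matrix (Fin M) (Fin n) ℂ}
    (hzeros : ∀ z : ℂ, IsTransmissionZero (transferMatrix A B C) z → z.re < 0)
    (hstab : IsStabilizable A B) (hdetect : IsDetectable A C)
    (hξ : IsModifiedLeftInteractor ξ (transferMatrix A B C))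
    (hP : ∀ s : ℂ, evalPolyMatrix ξ s * complexify C =
      P s * (s • (1 : Matrix (Fin n) (Fin n) ℂ) - complexify (A + B * K))) :
    IsHurwitz (A + B * K) := by
  refine isStablePoly_charpoly_iff.2 fun s hs v hv => ?_
  by_contra hv0
  have hv' : (s • (1 : Matrix (Fin n) (Fin n) ℂ) - complexify (A + B * K)) *ᵥ v = 0 := by
    rw [Matrix.sub_mulVec, Matrix.smul_mulVec, Matrix.one_mulVec, hv, sub_self]
  have hC : complexify C *ᵥ v = 0 := by
    have h1 : evalPolyMatrix ξ s *ᵥ (complexify C *ᵥ v) = 0 := by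
      rw [Matrix.mulVec_mulVec, hP, ← Matrix.mulVec_mulVec, hv', Matrix.mulVec_zero]
    have h2 := congrArg (fun x => (evalPolyMatrix ξ s)⁻¹ *ᵥ x) h1
    simpa [Matrix.mulVec_mulVec, ← Matrix.mul_assoc,
      Matrix.nonsing_inv_mul _ (hξ.isUnit_det hs)] using h2
  have hB : (s • (1 : Matrix (Fin n) (Fin n) ℂ) - complexify A) *ᵥ v =
      complexify B *ᵥ (complexify K *ᵥ v) := by
    rw [complexify_add, complexify_mul, ← sub_sub,
      Matrix.sub_mulVec _ (complexify B * complexify K), sub_eq_zero] at hv'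
    rw [hv', Matrix.mulVec_mulVec]
  by_cases hw : complexify K *ᵥ v = 0
  · obtain ⟨L, hL⟩ := hdetect
    refine hv0 (isStablePoly_charpoly_iff.1 hL s hs v ?_)
    rw [hw, Matrix.mulVec_zero, Matrix.sub_mulVec, Matrix.smul_mulVec, Matrix.one_mulVec,
      sub_eq_zero] at hB
    rw [complexify_sub, complexify_mul, Matrix.sub_mulVec, ← Matrix.mulVec_mulVec, hC,
      Matrix.mulVec_zero, sub_zero, hB]
  · exact absurd (hzeros s (isTransmissionZero_of_pencil hstab hs hw hB hC)) (not_lt.2 hs)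

end

/-! ### Spanning by the first observability blocks -/

/-- If `C₀` has full row rank, the blocks `C₀ A ^ k` with `k ≤ n - n₀` already detect every
vector that an observable pair detects. -/
lemma IsObservable.eq_zero_of_forall_le {n n₀ : ℕ} {A : Matrix (Fin n) (Fin n) ℝ}
    {C₀ : Matrix (Fin n₀) (Fin n) ℝ} (hobs : IsObservable A C₀) (hC₀ : C₀.rank = n₀)
    {v : Fin n → ℝ} (hv : ∀ k ≤ n - n₀, (C₀ * A ^ k) *ᵥ v = 0) : v = 0 := by
  let V (k : ℕ) : Submodule ℝ (Fin n → ℝ) := ⨅ j : Fin k, LinearMap.ker (C₀ * A ^ (j : ℕ)).mulVecLin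
  have hV (k : ℕ) (w : Fin n → ℝ) : w ∈ V k ↔ ∀ j < k, (C₀ * A ^ j) *ᵥ w = 0 := by
    simp only [V, Submodule.mem_iInf, LinearMap.mem_ker, Matrix.mulVecLin_apply]
    exact ⟨fun h j hj => h ⟨j, hj⟩, fun h j => h j j.2⟩
  have hanti (k : ℕ) : V (k + 1) ≤ V k := fun w hw =>
    (hV k w).2 fun j hj => (hV (k + 1) w).1 hw j (hj.trans k.lt_succ_self)
  have hstat (k : ℕ) (hk : V (k + 1) = V k) (m : ℕ) : V k ≤ V (k + m) := by
    induction m with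
    | zero => exact le_rfl
    | succ m ih =>
      intro w hw
      have hAw : A *ᵥ w ∈ V k := (hV k _).2 fun j hj => by
        have := (hV (k + 1) w).1 (hk ▸ hw) (j + 1) (by omega)
        rwa [pow_succ, ← Matrix.mul_assoc, ← Matrix.mulVec_mulVec] at this
      refine (hV _ w).2 fun j hj => ?_
      rcases j with _ | j
      · exact (hV (k + 1) w).1 (hk ▸ hw) 0 (by omega)
      · have := (hV _ _).1 (ih hAw) j (by omega)
        rwa [Matrix.mulVec_mulVec, Matrix.mul_assoc, ← pow_succ] at this
  have hbot (k : ℕ) (hk : V (k + 1) = V k) : V k = ⊥ := by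
    rw [eq_bot_iff]
    intro w hw
    refine hobs w fun j hj => ?_
    exact (hV _ w).1 (hstat k hk n hw) j (by omega)
  have hdim (k : ℕ) : V (k + 1) = ⊥ ∨ Module.finrank ℝ (V (k + 1)) + k ≤ n - n₀ := by
    induction k with
    | zero =>
      right
      have h1 : V 1 = LinearMap.ker C₀.mulVecLin := by
        ext w
        rw [hV, LinearMap.mem_ker, Matrix.mulVecLin_apply]
        exact ⟨fun h => by simpa using h 0 one_pos, fun h j hj => by
          obtain rfl : j = 0 := by omega
          simpa using h⟩
      have h2 := LinearMap.finrank_range_add_finrank_ker C₀.mulVecLin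
      rw [← Matrix.rank, hC₀, Module.finrank_fin_fun] at h2
      rw [zero_add, h1]
      omega
    | succ k ih =>
      rcases ih with h | h
      · exact Or.inl (eq_bot_iff.2 (h ▸ hanti (k + 1)))
      · by_cases he : V (k + 1 + 1) = V (k + 1)
        · exact Or.inl (he.trans (hbot _ he))
        · right
          have := Submodule.finrank_lt_finrank_of_lt (lt_of_le_of_ne (hanti (k + 1)) he)
          omega
  have hmem : v ∈ V (n - n₀ + 1) := (hV _ v).2 fun j hj => hv j (by omega)
  have : V (n - n₀ + 1) = ⊥ := by
    rcases hdim (n - n₀) with h | h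
    · exact h
    · exact Submodule.finrank_eq_zero.1 (by omega)
  rwa [this, Submodule.mem_bot] at hmem

lemma IsObservable.exists_sum_eq {n n₀ : ℕ} {m : Type*} {A : Matrix (Fin n) (Fin n) ℝ}
    {C₀ : Matrix (Fin n₀) (Fin n) ℝ} (hobs : IsObservable A C₀) (hC₀ : C₀.rank = n₀)
    (T : Matrix m (Fin n) ℝ) :
    ∃ h : ℕ → Matrix m (Fin n₀) ℝ, ∑ k ∈ Finset.range (n - n₀ + 1), h k * C₀ * A ^ k = T := by
  let O : Matrix (Fin (n - n₀ + 1) × Fin n₀) (Fin n) ℝ := fun ki => (C₀ * A ^ (ki.1 : ℕ)) ki.2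
  have hker : LinearMap.ker (Matrix.toLin' O) = ⊥ := by
    rw [LinearMap.ker_eq_bot']
    intro v hv
    refine hobs.eq_zero_of_forall_le hC₀ fun k hk => ?_
    ext i
    exact congrFun hv (⟨k, by omega⟩, i)
  obtain ⟨g, hg⟩ := LinearMap.exists_leftInverse_of_injective _ hker
  have hLO : LinearMap.toMatrix' g * O = 1 := by
    rw [← LinearMap.toMatrix'_toLin' O, ← LinearMap.toMatrix'_comp, hg, LinearMap.toMatrix'_id]
  set S := T * LinearMap.toMatrix' g with hS
  refine ⟨fun k => if hk : k < n - n₀ + 1 then Matrix.of fun a i => S a (⟨k, hk⟩, i) else 0, ?_⟩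
  have hT : T = S * O := by rw [hS, Matrix.mul_assoc, hLO, Matrix.mul_one]
  rw [Finset.sum_range]
  ext a i
  rw [hT, Matrix.mul_apply, Fintype.sum_prod_type, Matrix.sum_apply]
  refine Finset.sum_congr rfl fun k _ => ?_
  beta_reduce
  rw [dif_pos k.2, Matrix.mul_assoc]
  rfl

/-! ### The canonical realization of the regressor filter -/

section Canonical

variable {R : Type*} [CommRing R] {d : ℕ} {κ κ' : Type*}

/-- The companion matrix of a monic polynomial of degree `d`, with ones above the diagonal. -/
def companion (d : ℕ) (p : R[X]) : Matrix (Fin d) (Fin d) R :=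
  fun j k => (if (k : ℕ) = j + 1 then 1 else 0) - if (j : ℕ) + 1 = d then p.coeff k else 0

/-- The state matrix of the canonical realization of the filter `[I, s I, …]ᵀ / p(s)`. -/
def filterState (d : ℕ) (κ : Type*) [DecidableEq κ] (p : R[X]) :
    Matrix (Fin d × κ) (Fin d × κ) R :=
  companion d p ⊗ₖ (1 : Matrix κ κ R)

/-- The input matrix of the canonical realization of the filter `[I, s I, …]ᵀ / p(s)`. -/
def filterInput (R : Type*) [CommRing R] (d : ℕ) (κ : Type*) [DecidableEq κ] :
    Matrix (Fin d × κ) κ R :=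
  fun ji l => if (ji.1 : ℕ) + 1 = d then (1 : Matrix κ κ R) ji.2 l else 0

/-- Blockwise application of a matrix. -/
def blockwise (d : ℕ) (T : Matrix κ' κ R) : Matrix (Fin d × κ') (Fin d × κ) R :=
  (1 : Matrix (Fin d) (Fin d) R) ⊗ₖ T

lemma blockwise_mulVec_apply [Fintype κ] (T : Matrix κ' κ R) (z : Fin d × κ → R) (j : Fin d)
    (i : κ') :
    (blockwise d T *ᵥ z) (j, i) = (T *ᵥ fun l => z (j, l)) i := by
  simp [blockwise, Matrix.mulVec, dotProduct, Fintype.sum_prod_type, Matrix.one_apply,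
    Matrix.kroneckerMap_apply]

lemma filterInput_mulVec_apply [Fintype κ] [DecidableEq κ] (u : κ → R) (j : Fin d) (i : κ) :
    (filterInput R d κ *ᵥ u) (j, i) = if (j : ℕ) + 1 = d then u i else 0 := by
  split_ifs with h <;> simp [filterInput, Matrix.mulVec, dotProduct, Matrix.one_apply, h]

lemma filterState_mulVec_apply [Fintype κ] [DecidableEq κ] (p : R[X]) (z : Fin d × κ → R)
    (j : Fin d) (i : κ) :
    (filterState d κ p *ᵥ z) (j, i) =
      if h : (j : ℕ) + 1 < d then z (⟨j + 1, h⟩, i) else -∑ k : Fin d, p.coeff k * z (k, i) := by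
  have h1 : (filterState d κ p *ᵥ z) (j, i) = ∑ k, companion d p j k * z (k, i) := by
    simp [filterState, Matrix.mulVec, dotProduct, Fintype.sum_prod_type, Matrix.one_apply,
      Matrix.kroneckerMap_apply]
  rw [h1]
  split_ifs with h
  · rw [Finset.sum_eq_single ⟨j + 1, h⟩]
    · simp [companion, h.ne]
    · intro k _ hk
      have : (k : ℕ) ≠ j + 1 := fun h' => hk (Fin.ext h')
      simp [companion, h.ne, this]
    · simp
  · rw [← Finset.sum_neg_distrib]
    refine Finset.sum_congr rfl fun k _ => ?_
    have h2 : (k : ℕ) ≠ j + 1 := by omega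
    have h3 : (j : ℕ) + 1 = d := by omega
    simp only [companion, if_neg h2, if_pos h3]
    ring

lemma blockwise_mulVec_filterState [Fintype κ] [DecidableEq κ] [Fintype κ'] [DecidableEq κ']
    (p : R[X]) (T : Matrix κ' κ R) (z : Fin d × κ → R) :
    blockwise d T *ᵥ (filterState d κ p *ᵥ z) = filterState d κ' p *ᵥ (blockwise d T *ᵥ z) := by
  rw [Matrix.mulVec_mulVec, Matrix.mulVec_mulVec, blockwise, filterState, filterState,
    ← Matrix.mul_kronecker_mul, ← Matrix.mul_kronecker_mul]
  simp

lemma blockwise_mulVec_filterInput [Fintype κ] [DecidableEq κ] [Fintype κ'] [DecidableEq κ']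
    (T : Matrix κ' κ R) (u : κ → R) :
    blockwise d T *ᵥ (filterInput R d κ *ᵥ u) = filterInput R d κ' *ᵥ (T *ᵥ u) := by
  ext ⟨j, i⟩
  rw [blockwise_mulVec_apply, filterInput_mulVec_apply]
  simp only [filterInput_mulVec_apply]
  split_ifs
  · rfl
  · exact congrFun (Matrix.mulVec_zero T) i

lemma complexify_filterState [DecidableEq κ] (p : ℝ[X]) :
    complexify (filterState d κ p) = filterState d κ (p.map (algebraMap ℝ ℂ)) := by
  ext ⟨j, i⟩ ⟨k, l⟩
  simp [filterState, companion, Matrix.kroneckerMap_apply, Matrix.one_apply]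
  split_ifs <;> simp

lemma complexify_filterInput [DecidableEq κ] :
    complexify (filterInput ℝ d κ) = filterInput ℂ d κ := by
  ext ⟨j, i⟩ k
  simp [filterInput, Matrix.one_apply]
  split_ifs <;> simp

lemma eval_eq_pow_add_sum {p : R[X]} (hp : p.Monic) (hd : p.natDegree = d) (s : R) :
    p.eval s = s ^ d + ∑ k : Fin d, p.coeff k * s ^ (k : ℕ) := by
  rw [Polynomial.eval_eq_sum_range, hd, Finset.sum_range_succ, ← hd, hp.coeff_natDegree, one_mul,
    Finset.sum_range, add_comm, hd]

lemma isStablePoly_charpoly_filterState [Fintype κ] [DecidableEq κ] {Λ : ℝ[X]}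
    (hm : Λ.Monic) (hd : Λ.natDegree = d)
    (hs : IsStablePoly Λ) : IsStablePoly (filterState d κ Λ).charpoly := by
  refine isStablePoly_charpoly_iff.2 fun s hs0 v hv => ?_
  have hΛ : (Λ.map (algebraMap ℝ ℂ)).eval s ≠ 0 := by
    rw [Polynomial.eval_map_algebraMap]
    exact fun h => absurd (hs s h) (not_lt.2 hs0)
  rw [complexify_filterState] at hv
  have hv' (j : Fin d) (i : κ) := congrFun hv (j, i)
  simp only [filterState_mulVec_apply, Pi.smul_apply, smul_eq_mul] at hv'
  ext ⟨⟨j, hj⟩, i⟩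
  have hd0 : 0 < d := by omega
  have hpow (k : ℕ) (hk : k < d) : v (⟨k, hk⟩, i) = s ^ k * v (⟨0, hd0⟩, i) := by
    induction k with
    | zero => simp
    | succ k ih =>
      have := hv' ⟨k, by omega⟩ i
      rw [dif_pos hk, ih (by omega)] at this
      rw [this]
      ring
  have hlast := hv' ⟨d - 1, by omega⟩ i
  rw [dif_neg (by simp; omega), hpow (d - 1) (by omega)] at hlast
  have h0 : (Λ.map (algebraMap ℝ ℂ)).eval s * v (⟨0, hd0⟩, i) = 0 := by
    rw [eval_eq_pow_add_sum (hm.map _) (by rw [Polynomial.natDegree_map, hd]), add_mul,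
      Finset.sum_mul]
    have h1 : ∑ k : Fin d, (Λ.map (algebraMap ℝ ℂ)).coeff k * v (k, i) =
        ∑ k : Fin d, (Λ.map (algebraMap ℝ ℂ)).coeff k * s ^ (k : ℕ) * v (⟨0, hd0⟩, i) :=
      Finset.sum_congr rfl fun k _ => by rw [hpow k k.2]; ring
    have h2 : s ^ d = s * s ^ (d - 1) := by rw [← pow_succ', Nat.sub_add_cancel hd0]
    rw [← h1, h2]
    linear_combination -hlast
  rw [hpow j hj, (mul_eq_zero.1 h0).resolve_left hΛ, mul_zero]
  rfl

/-- The canonical realization realizes the regressor filter. -/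
lemma isResponse_regressorFilter {q : ℕ} {Λ : ℝ[X]} (hm : Λ.Monic) (hd : Λ.natDegree = d)
    (hs : IsStablePoly Λ) {u : ℝ → Fin q → ℝ} {z : ℝ → Fin d × Fin q → ℝ}
    (hu : ∀ t, 0 ≤ t → IntervalIntegrable u volume 0 t)
    (hz : HasVelocity z (fun t => filterState d (Fin q) Λ *ᵥ z t + filterInput ℝ d (Fin q) *ᵥ u t)) :
    IsResponse (regressorFilter d q Λ) u z := by
  have := isResponse_of_hasVelocity (J := 1) (W := regressorFilter d q Λ)
    (isStablePoly_charpoly_filterState hm hd hs) (fun s hs0 => ?_) hu hz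
  · simpa using this
  refine ⟨regressorFilter d q Λ s, ?_, by rw [complexify_one, Matrix.one_mul]⟩
  have hΛ : Polynomial.aeval s Λ ≠ 0 := fun h => absurd (hs s h) (not_lt.2 hs0)
  rw [Matrix.sub_mul, Matrix.smul_mul, Matrix.one_mul, sub_eq_iff_eq_add, complexify_filterState,
    complexify_filterInput]
  ext ⟨j, i⟩ l
  have h1 := filterState_mulVec_apply (Λ.map (algebraMap ℝ ℂ))
    (fun ki => regressorFilter d q Λ s ki l) j i
  have h2 : (filterState d (Fin q) (Λ.map (algebraMap ℝ ℂ)) * regressorFilter d q Λ s) (j, i) l =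
      (filterState d (Fin q) (Λ.map (algebraMap ℝ ℂ)) *ᵥ
        fun ki => regressorFilter d q Λ s ki l) (j, i) := rfl
  rw [Matrix.add_apply, h2, h1, Matrix.smul_apply, smul_eq_mul]
  simp only [regressorFilter, filterInput, Matrix.one_apply]
  by_cases hil : i = l
  · simp only [hil, if_true]
    split_ifs with h3 h4 h4
    · omega
    · have h5 := eval_eq_pow_add_sum (hm.map (algebraMap ℝ ℂ))
        (by rw [Polynomial.natDegree_map, hd]) s
      rw [Polynomial.eval_map_algebraMap] at h5
      have h6 : ∑ k : Fin d, (Λ.map (algebraMap ℝ ℂ)).coeff k *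
          (s ^ (k : ℕ) / Polynomial.aeval s Λ) =
          (∑ k : Fin d, (Λ.map (algebraMap ℝ ℂ)).coeff k * s ^ (k : ℕ)) / Polynomial.aeval s Λ := by
        rw [Finset.sum_div]
        exact Finset.sum_congr rfl fun k _ => by ring
      have h7 : s * s ^ (j : ℕ) = s ^ d := by rw [← pow_succ', h3]
      rw [h6, add_comm, ← mul_div_assoc, h7, div_eq_iff hΛ, add_mul, neg_mul, div_mul_cancel₀ _ hΛ,
        one_mul]
      linear_combination -h5
    · rw [zero_add, pow_succ]
      field_simp
    · omega
  · simp [hil]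

end Canonical

/-- A matrix given by a row of blocks. -/
def rowBlocks {d : ℕ} {m κ : Type*} (N : Fin d → Matrix m κ ℝ) : Matrix m (Fin d × κ) ℝ :=
  fun a ji => N ji.1 a ji.2

lemma rowBlocks_mulVec {d : ℕ} {m κ : Type*} [Fintype κ] (N : Fin d → Matrix m κ ℝ)
    (z : Fin d × κ → ℝ) : rowBlocks N *ᵥ z = ∑ j, N j *ᵥ fun i => z (j, i) := by
  ext a
  simp [rowBlocks, Matrix.mulVec, dotProduct, Fintype.sum_prod_type]

/-- `K x` is a combination of `x₀ = C₀ x`, of the filtered `x₀` and of the filtered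
`x' - A x`. -/
lemma exists_observer_gains {n n₀ : ℕ} {m : Type*} {A : Matrix (Fin n) (Fin n) ℝ}
    {C₀ : Matrix (Fin n₀) (Fin n) ℝ} (hobs : IsObservable A C₀) (hC₀ : C₀.rank = n₀) {Λ : ℝ[X]}
    (hm : Λ.Monic) (hd : Λ.natDegree = n - n₀) (K : Matrix m (Fin n) ℝ) :
    ∃ (N : Matrix m (Fin (n - n₀) × Fin n) ℝ) (N₂ : Matrix m (Fin (n - n₀) × Fin n₀) ℝ)
      (N₀ : Matrix m (Fin n₀) ℝ), ∀ (x : Fin n → ℝ) (ζ : Fin (n - n₀) × Fin n → ℝ),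
      N *ᵥ (filterState (n - n₀) (Fin n) Λ *ᵥ ζ + filterInput ℝ (n - n₀) (Fin n) *ᵥ x -
        blockwise (n - n₀) A *ᵥ ζ) + N₂ *ᵥ (blockwise (n - n₀) C₀ *ᵥ ζ) + N₀ *ᵥ (C₀ *ᵥ x) =
        K *ᵥ x := by
  set d := n - n₀ with hdd
  obtain ⟨h, hh⟩ := hobs.exists_sum_eq hC₀ (∑ k ∈ Finset.range (d + 1), Λ.coeff k • (K * A ^ k))
  rw [← hdd] at hh
  set p : ℕ → Matrix m (Fin n) ℝ := fun k => Λ.coeff k • K - h k * C₀ with hp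
  have hpA : ∑ k ∈ Finset.range (d + 1), p k * A ^ k = 0 := by
    simp only [hp, Matrix.sub_mul, Finset.sum_sub_distrib, hh, Matrix.smul_mul, sub_self]
  refine ⟨rowBlocks fun j => ∑ k ∈ Finset.range (d + 1),
      if (j : ℕ) < k then p k * A ^ (k - 1 - j) else 0,
    rowBlocks fun j => h j - Λ.coeff j • h d, h d, fun x ζ => ?_⟩
  set Z : ℕ → Fin n → ℝ := fun k =>
    if hk : k < d then fun i => ζ (⟨k, hk⟩, i) else x - ∑ j : Fin d, Λ.coeff j • fun i => ζ (j, i)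
    with hZ
  have hZlt (j : Fin d) : (fun i => ζ (j, i)) = Z j := by simp [hZ]
  have hZd : Z d = x - ∑ j : Fin d, Λ.coeff j • Z j := by
    simp only [← hZlt]
    simp [hZ]
  have hη (j : Fin d) : (fun i => (filterState d (Fin n) Λ *ᵥ ζ + filterInput ℝ d (Fin n) *ᵥ x -
      blockwise d A *ᵥ ζ) (j, i)) = Z (j + 1) - A *ᵥ Z j := by
    ext i
    rw [Pi.sub_apply, Pi.add_apply, Pi.sub_apply, filterState_mulVec_apply,
      filterInput_mulVec_apply, blockwise_mulVec_apply, hZlt]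
    congr 1
    by_cases hj : (j : ℕ) + 1 < d
    · simp [hZ, hj, hj.ne]
    · have hj' : (j : ℕ) + 1 = d := by omega
      rw [dif_neg hj, if_pos hj', hj', hZd, Pi.sub_apply, Finset.sum_apply]
      simp only [← hZlt, Pi.smul_apply, smul_eq_mul]
      ring
  have htel (k : ℕ) : Z k = A ^ k *ᵥ Z 0 +
      ∑ j ∈ Finset.range k, A ^ (k - 1 - j) *ᵥ (Z (j + 1) - A *ᵥ Z j) := by
    induction k with
    | zero => simp
    | succ k ih =>
      rw [Finset.sum_range_succ]
      have h1 : ∑ j ∈ Finset.range k, A ^ (k + 1 - 1 - j) *ᵥ (Z (j + 1) - A *ᵥ Z j) =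
          A *ᵥ ∑ j ∈ Finset.range k, A ^ (k - 1 - j) *ᵥ (Z (j + 1) - A *ᵥ Z j) := by
        rw [Matrix.mulVec_sum]
        refine Finset.sum_congr rfl fun j hj => ?_
        rw [Finset.mem_range] at hj
        rw [Matrix.mulVec_mulVec, ← pow_succ']
        congr 2
        omega
      rw [h1, pow_succ', ← Matrix.mulVec_mulVec, ← add_assoc, ← Matrix.mulVec_add, ← ih]
      simp
  have hN : rowBlocks (fun j : Fin d => ∑ k ∈ Finset.range (d + 1),
      if (j : ℕ) < k then p k * A ^ (k - 1 - j) else 0) *ᵥ (filterState d (Fin n) Λ *ᵥ ζ +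
        filterInput ℝ d (Fin n) *ᵥ x - blockwise d A *ᵥ ζ) =
      ∑ k ∈ Finset.range (d + 1), p k *ᵥ Z k := by
    rw [rowBlocks_mulVec]
    simp only [hη, Matrix.sum_mulVec]
    rw [Finset.sum_comm]
    have h1 (k : ℕ) (hk : k ∈ Finset.range (d + 1)) :
        ∑ j : Fin d, (if (j : ℕ) < k then p k * A ^ (k - 1 - j) else 0) *ᵥ
          (Z (j + 1) - A *ᵥ Z j) = p k *ᵥ Z k - (p k * A ^ k) *ᵥ Z 0 := by
      rw [Finset.mem_range] at hk
      conv_rhs => rw [htel k]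
      rw [Matrix.mulVec_add, Matrix.mulVec_mulVec, add_sub_cancel_left, Matrix.mulVec_sum,
        ← Finset.sum_range fun j => (if j < k then p k * A ^ (k - 1 - j) else 0) *ᵥ
          (Z (j + 1) - A *ᵥ Z j)]
      symm
      refine Finset.sum_subset_zero_on_sdiff (Finset.range_subset_range.2 (by omega)) ?_ ?_
      · intro j hj
        simp only [Finset.mem_sdiff, Finset.mem_range] at hj
        rw [if_neg hj.2, Matrix.zero_mulVec]
      · intro j hj
        rw [if_pos (Finset.mem_range.1 hj), Matrix.mulVec_mulVec]
    rw [Finset.sum_congr rfl h1, Finset.sum_sub_distrib, ← Matrix.sum_mulVec, hpA,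
      Matrix.zero_mulVec, sub_zero]
  have hx : x = ∑ k ∈ Finset.range (d + 1), Λ.coeff k • Z k := by
    rw [Finset.sum_range_succ, Finset.sum_range, hZd, ← hd, hm.coeff_natDegree, one_smul, hd]
    abel
  have hblock (j : Fin d) : (fun i => (blockwise d C₀ *ᵥ ζ) (j, i)) = C₀ *ᵥ Z j := by
    ext i
    rw [blockwise_mulVec_apply, hZlt]
  rw [hN, rowBlocks_mulVec]
  simp only [hblock]
  have h2 : ∑ j : Fin d, (h j - Λ.coeff j • h d) *ᵥ (C₀ *ᵥ Z j) + h d *ᵥ (C₀ *ᵥ x) =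
      ∑ k ∈ Finset.range (d + 1), (h k * C₀) *ᵥ Z k := by
    rw [Finset.sum_range_succ, Finset.sum_range, hZd]
    simp only [Matrix.sub_mul, Matrix.smul_mul, Matrix.sub_mulVec, Finset.sum_sub_distrib,
      Matrix.mulVec_sub, Matrix.mulVec_sum,
      Matrix.mulVec_smul, Matrix.smul_mulVec, Matrix.mulVec_mulVec]
    abel
  rw [add_assoc, h2, ← Finset.sum_add_distrib]
  conv_rhs => rw [hx, Matrix.mulVec_sum]
  refine Finset.sum_congr rfl fun k _ => ?_
  rw [← Matrix.add_mulVec, hp, sub_add_cancel, Matrix.smul_mulVec, Matrix.mulVec_smul]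

lemma HasVelocity.mulVec {ι κ : Type*} [Fintype ι] [Fintype κ] {z w : ℝ → ι → ℝ}
    (h : HasVelocity z w) (T : Matrix κ ι ℝ) :
    HasVelocity (fun t => T *ᵥ z t) (fun t => T *ᵥ w t) :=
  h.map (Matrix.mulVecLin T).toContinuousLinearMap

lemma DecaysAt.mulVec {ι κ : Type*} [Fintype ι] [Fintype κ] {μ : ℝ} {f : ℝ → ι → ℝ}
    (h : DecaysAt μ f) (T : Matrix κ ι ℝ) : DecaysAt μ (fun t => T *ᵥ f t) :=
  h.map (Matrix.mulVecLin T).toContinuousLinearMap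

lemma isBoundedSignal_iff_decaysAt_zero {p : Type*} [Fintype p] {f : ℝ → p → ℝ} :
    IsBoundedSignal f ↔ DecaysAt 0 f := by
  simp [IsBoundedSignal, DecaysAt]

lemma DecaysAt.isExpDecaying {p : Type*} [Fintype p] {μ : ℝ} (hμ : 0 < μ) {f : ℝ → p → ℝ}
    (h : DecaysAt μ f) : IsExpDecaying f :=
  h.elim fun c hc => ⟨c, μ, hμ, hc⟩

lemma intervalIntegrable_mulVec {ι κ : Type*} [Fintype ι] [Fintype κ] {u : ℝ → ι → ℝ} {a b : ℝ}
    (h : IntervalIntegrable u volume a b) (T : Matrix κ ι ℝ) :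
    IntervalIntegrable (fun t => T *ᵥ u t) volume a b :=
  ⟨(Matrix.mulVecLin T).toContinuousLinearMap.integrable_comp h.1,
    (Matrix.mulVecLin T).toContinuousLinearMap.integrable_comp h.2⟩

lemma intervalIntegrable_of_continuousOn_Ici {E : Type*} [NormedAddCommGroup E] {f : ℝ → E}
    (h : ContinuousOn f (Ici 0)) {t : ℝ} (ht : 0 ≤ t) : IntervalIntegrable f volume 0 t :=
  (h.mono (by rw [uIcc_of_le ht]; exact Icc_subset_Ici_self)).intervalIntegrable

lemma IsBoundedSignal.intervalIntegrable {p : Type*} [Fintype p] {r : ℝ → p → ℝ}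
    (hb : IsBoundedSignal r) (hr : Measurable r) {t : ℝ} (ht : 0 ≤ t) :
    IntervalIntegrable r volume 0 t := by
  obtain ⟨b, hb⟩ := hb
  rw [intervalIntegrable_iff_integrableOn_Ioc_of_le ht]
  refine Measure.integrableOn_of_bounded (M := b) (by simp) hr.aestronglyMeasurable ?_
  filter_upwards [ae_restrict_mem measurableSet_Ioc] with s hs
  exact hb s hs.1.le

/-- A linear system with a locally integrable input has a solution for every initial state. -/
lemma exists_hasVelocity_mulVec {ι q : Type*} [Fintype ι] [Fintype q] (F : Matrix ι ι ℝ)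
    (H : Matrix ι q ℝ) {u : ℝ → q → ℝ} (hu : ∀ t, 0 ≤ t → IntervalIntegrable u volume 0 t) :
    ∃ z : ℝ → ι → ℝ, HasVelocity z (fun t => F *ᵥ z t + H *ᵥ u t) :=
  (exists_hasVelocity (Matrix.mulVecLin F).toContinuousLinearMap
    (fun t ht => intervalIntegrable_mulVec (hu t ht) H) 0).imp fun _ h => h.2

/-- With the gains of `exists_observer_gains`, the partial-state feedback reproduces the state
feedback `K x` up to a decaying error. -/
lemma exists_decaysAt_observer_error {n M n₀ d : ℕ} {m : Type*} [Fintype m]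
    {A : Matrix (Fin n) (Fin n) ℝ} {B : Matrix (Fin n) (Fin M) ℝ} {C₀ : Matrix (Fin n₀) (Fin n) ℝ}
    {Λ : ℝ[X]} (hm : Λ.Monic) (hd : Λ.natDegree = d) (hΛ : IsStablePoly Λ)
    {K : Matrix m (Fin n) ℝ} {N : Matrix m (Fin d × Fin n) ℝ} {N₂ : Matrix m (Fin d × Fin n₀) ℝ}
    {N₀ : Matrix m (Fin n₀) ℝ}
    (hN : ∀ (x : Fin n → ℝ) (ζ : Fin d × Fin n → ℝ),
      N *ᵥ (filterState d (Fin n) Λ *ᵥ ζ + filterInput ℝ d (Fin n) *ᵥ x - blockwise d A *ᵥ ζ) +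
        N₂ *ᵥ (blockwise d C₀ *ᵥ ζ) + N₀ *ᵥ (C₀ *ᵥ x) = K *ᵥ x)
    {u : ℝ → Fin M → ℝ} {x : ℝ → Fin n → ℝ} {ω₁ : ℝ → Fin d × Fin M → ℝ}
    {ω₂ : ℝ → Fin d × Fin n₀ → ℝ} (hx : IsTrajectory A B u x)
    (h₁ : IsResponse (regressorFilter d M Λ) u ω₁)
    (h₂ : IsResponse (regressorFilter d n₀ Λ) (fun t => C₀ *ᵥ x t) ω₂) :
    ∃ μ : ℝ, 0 < μ ∧ DecaysAt μ (fun t => (N * blockwise d B) *ᵥ ω₁ t + N₂ *ᵥ ω₂ t +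
      N₀ *ᵥ (C₀ *ᵥ x t) - K *ᵥ x t) := by
  have hxi (t : ℝ) (ht : 0 ≤ t) : IntervalIntegrable x volume 0 t :=
    intervalIntegrable_of_continuousOn_Ici hx.continuousOn ht
  obtain ⟨ζ, hζ⟩ := exists_hasVelocity_mulVec (filterState d (Fin n) Λ)
    (filterInput ℝ d (Fin n)) hxi
  obtain ⟨z, hz⟩ := exists_hasVelocity_mulVec (filterState d (Fin M) Λ)
    (filterInput ℝ d (Fin M)) hx.input_integrable
  obtain ⟨μ₁, hμ₁, e₁⟩ := h₁.exists_decaysAt_sub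
    (isResponse_regressorFilter hm hd hΛ hx.input_integrable hz)
  obtain ⟨μ₂, hμ₂, e₂⟩ := h₂.exists_decaysAt_sub
    (isResponse_regressorFilter hm hd hΛ (fun t ht => intervalIntegrable_mulVec (hxi t ht) C₀)
      ((hζ.mulVec (blockwise d C₀)).congr (fun _ _ => rfl) fun t _ => by
        rw [Matrix.mulVec_add, blockwise_mulVec_filterState, blockwise_mulVec_filterInput]))
  obtain ⟨μ₃, hμ₃, hrate⟩ :=
    exists_rate (isStablePoly_charpoly_filterState (κ := Fin n) hm hd hΛ)
  set η : ℝ → Fin d × Fin n → ℝ := fun t =>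
    filterState d (Fin n) Λ *ᵥ ζ t + filterInput ℝ d (Fin n) *ᵥ x t - blockwise d A *ᵥ ζ t with hη
  have hηv := ((hζ.mulVec (filterState d (Fin n) Λ)).add
    (hx.hasVelocity.mulVec (filterInput ℝ d (Fin n)))).sub (hζ.mulVec (blockwise d A))
  have e₃ : DecaysAt μ₃ (fun t => blockwise d B *ᵥ z t - η t) := by
    refine hrate μ₃ le_rfl _ (fun _ => 0)
      (((hz.mulVec (blockwise d B)).sub hηv).congr (fun _ _ => rfl) fun t _ => ?_)
      (DecaysAt.zero _)
    simp only [hη, Matrix.mulVec_add, Matrix.mulVec_sub, blockwise_mulVec_filterState,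
      blockwise_mulVec_filterInput]
    abel
  set μ := min μ₁ (min μ₂ μ₃) with hμ
  refine ⟨μ, lt_min hμ₁ (lt_min hμ₂ hμ₃), ?_⟩
  have f₁ := (e₁.mono (min_le_left _ _ : μ ≤ μ₁)).mulVec (N * blockwise d B)
  have f₂ := (e₂.mono ((min_le_right _ _).trans (min_le_left _ _) : μ ≤ μ₂)).mulVec N₂
  have f₃ := (e₃.mono ((min_le_right _ _).trans (min_le_right _ _) : μ ≤ μ₃)).mulVec N
  refine ((f₁.add f₂).add f₃).congr fun t _ => ?_
  rw [← hN (x t) (ζ t)]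
  simp only [hη, Matrix.mulVec_sub, Matrix.mulVec_add, Matrix.mulVec_mulVec]
  abel

lemma isTrajectory_of_hasVelocity {k : ℕ} {q : Type*} [Fintype q] {A : Matrix (Fin k) (Fin k) ℝ}
    {B : Matrix (Fin k) q ℝ} {u : ℝ → q → ℝ} {x : ℝ → Fin k → ℝ}
    (hu : ∀ t, 0 ≤ t → IntervalIntegrable u volume 0 t)
    (h : HasVelocity x (fun t => A *ᵥ x t + B *ᵥ u t)) : IsTrajectory A B u x :=
  ⟨hu, h.continuousOn, h.eq⟩

/-- The closed loop has a solution for every initial state of the plant. -/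
lemma exists_isClosedLoop {n M n₀ : ℕ} (A : Matrix (Fin n) (Fin n) ℝ)
    (B : Matrix (Fin n) (Fin M) ℝ) (C₀ : Matrix (Fin n₀) (Fin n) ℝ) {Λ : ℝ[X]} (hm : Λ.Monic)
    (hd : Λ.natDegree = n - n₀) (hΛ : IsStablePoly Λ)
    (Θ₁ : Matrix (Fin (n - n₀) × Fin M) (Fin M) ℝ)
    (Θ₂ : Matrix (Fin (n - n₀) × Fin n₀) (Fin M) ℝ)
    (Θ₂₀ : Matrix (Fin n₀) (Fin M) ℝ) (Θ₃ : Matrix (Fin M) (Fin M) ℝ) {r : ℝ → Fin M → ℝ}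
    (hr : ∀ t, 0 ≤ t → IntervalIntegrable r volume 0 t) (x₀ : Fin n → ℝ) :
    ∃ x u ω₁ ω₂, x 0 = x₀ ∧ IsClosedLoop A B C₀ Λ Θ₁ Θ₂ Θ₂₀ Θ₃ r x u ω₁ ω₂ := by
  let E := (Fin n → ℝ) × (Fin (n - n₀) × Fin M → ℝ) × (Fin (n - n₀) × Fin n₀ → ℝ)
  let px : E →ₗ[ℝ] (Fin n → ℝ) := LinearMap.fst ℝ _ _
  let p₁ : E →ₗ[ℝ] (Fin (n - n₀) × Fin M → ℝ) := LinearMap.fst ℝ _ _ ∘ₗ LinearMap.snd ℝ _ _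
  let p₂ : E →ₗ[ℝ] (Fin (n - n₀) × Fin n₀ → ℝ) := LinearMap.snd ℝ _ _ ∘ₗ LinearMap.snd ℝ _ _
  let U : E →ₗ[ℝ] (Fin M → ℝ) := Θ₁ᵀ.mulVecLin ∘ₗ p₁ + Θ₂ᵀ.mulVecLin ∘ₗ p₂ +
    Θ₂₀ᵀ.mulVecLin ∘ₗ C₀.mulVecLin ∘ₗ px
  let L : E →ₗ[ℝ] E := (A.mulVecLin ∘ₗ px + B.mulVecLin ∘ₗ U).prod
    (((filterState (n - n₀) (Fin M) Λ).mulVecLin ∘ₗ p₁ +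
      (filterInput ℝ (n - n₀) (Fin M)).mulVecLin ∘ₗ U).prod
      ((filterState (n - n₀) (Fin n₀) Λ).mulVecLin ∘ₗ p₂ +
        (filterInput ℝ (n - n₀) (Fin n₀)).mulVecLin ∘ₗ C₀.mulVecLin ∘ₗ px))
  let G : (Fin M → ℝ) →ₗ[ℝ] E := ((B.mulVecLin ∘ₗ Θ₃.mulVecLin).prod
    (((filterInput ℝ (n - n₀) (Fin M)).mulVecLin ∘ₗ Θ₃.mulVecLin).prod 0))
  obtain ⟨z, hz0, hz⟩ := exists_hasVelocity L.toContinuousLinearMap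
    (g := fun t => G.toContinuousLinearMap (r t))
    (fun t ht => ⟨G.toContinuousLinearMap.integrable_comp (hr t ht).1,
      G.toContinuousLinearMap.integrable_comp (hr t ht).2⟩) (x₀, 0, 0)
  set u : ℝ → Fin M → ℝ := fun t => U (z t) + Θ₃ *ᵥ r t with hu
  have hui (t : ℝ) (ht : 0 ≤ t) : IntervalIntegrable u volume 0 t :=
    (intervalIntegrable_of_continuousOn_Ici
      (U.toContinuousLinearMap.continuous.comp_continuousOn hz.continuousOn) ht).add
      (intervalIntegrable_mulVec (hr t ht) Θ₃)
  have hx : HasVelocity (fun t => px (z t)) (fun t => A *ᵥ px (z t) + B *ᵥ u t) :=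
    (hz.map px.toContinuousLinearMap).congr (fun _ _ => rfl) fun t _ => by
      rw [hu, Matrix.mulVec_add, ← add_assoc]
      rfl
  have h₁ : HasVelocity (fun t => p₁ (z t))
      (fun t => filterState (n - n₀) (Fin M) Λ *ᵥ p₁ (z t) + filterInput ℝ (n - n₀) (Fin M) *ᵥ u t) :=
    (hz.map p₁.toContinuousLinearMap).congr (fun _ _ => rfl) fun t _ => by
      rw [hu, Matrix.mulVec_add, ← add_assoc]
      rfl
  have h₂ : HasVelocity (fun t => p₂ (z t))
      (fun t => filterState (n - n₀) (Fin n₀) Λ *ᵥ p₂ (z t) +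
        filterInput ℝ (n - n₀) (Fin n₀) *ᵥ (C₀ *ᵥ px (z t))) :=
    (hz.map p₂.toContinuousLinearMap).congr (fun _ _ => rfl) fun t _ => (add_zero _).symm
  refine ⟨fun t => px (z t), u, fun t => p₁ (z t), fun t => p₂ (z t), congrArg Prod.fst hz0,
    isTrajectory_of_hasVelocity hui hx, isResponse_regressorFilter hm hd hΛ hui h₁,
    isResponse_regressorFilter hm hd hΛ (fun t ht => ?_) h₂, fun t _ => rfl⟩
  exact intervalIntegrable_mulVec (intervalIntegrable_of_continuousOn_Ici hx.continuousOn ht) C₀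

/-- The state feedback loop realizes the reference model `ξ⁻¹`. -/
lemma isResponse_reference {n M : ℕ} {A : Matrix (Fin n) (Fin n) ℝ}
    {B : Matrix (Fin n) (Fin M) ℝ} {C : Matrix (Fin M) (Fin n) ℝ}
    {ξ : Matrix (Fin M) (Fin M) ℝ[X]} {Kp : Matrix (Fin M) (Fin M) ℝ}
    {P : ℂ → Matrix (Fin M) (Fin n) ℂ} (hA : IsHurwitz A) (hKp : Kp.det ≠ 0)
    (hP : ∀ s : ℂ, evalPolyMatrix ξ s * complexify C =
      P s * (s • (1 : Matrix (Fin n) (Fin n) ℂ) - complexify A) ∧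
      P s * complexify B = complexify Kp) {r : ℝ → Fin M → ℝ} {z : ℝ → Fin n → ℝ}
    (hr : ∀ t, 0 ≤ t → IntervalIntegrable r volume 0 t)
    (hz : HasVelocity z (fun t => A *ᵥ z t + (B * Kp⁻¹) *ᵥ r t)) :
    IsResponse (fun s => (evalPolyMatrix ξ s)⁻¹) r (fun t => C *ᵥ z t) := by
  refine isResponse_of_hasVelocity hA (fun s hs => ?_) hr hz
  have hu := isUnit_det_of_isStablePoly hA hs
  refine ⟨(s • (1 : Matrix (Fin n) (Fin n) ℂ) - complexify A)⁻¹ * complexify (B * Kp⁻¹),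
    Matrix.mul_nonsing_inv_cancel_left _ _ hu, (Matrix.inv_eq_right_inv ?_).symm⟩
  rw [← Matrix.mul_assoc, (hP s).1, Matrix.mul_assoc,
    Matrix.mul_nonsing_inv_cancel_left _ _ hu, complexify_mul, ← Matrix.mul_assoc, (hP s).2,
    ← complexify_mul, Matrix.mul_nonsing_inv _ (isUnit_iff_ne_zero.2 hKp), complexify_one]

end PartialStateMRC

end

open PartialStateMRC in
theorem theorem3p1 (n M n₀ : ℕ)
    (A : Matrix (Fin n) (Fin n) ℝ) (B : Matrix (Fin n) (Fin M) ℝ) (C : Matrix (Fin M) (Fin n) ℝ)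
    (C₀ : Matrix (Fin n₀) (Fin n) ℝ) (ξ : Matrix (Fin M) (Fin M) ℝ[X]) (Λ : ℝ[X])
    (hzeros : ∀ z : ℂ,
      PartialStateMRC.IsTransmissionZero (PartialStateMRC.transferMatrix A B C) z → z.re < 0)
    (hstab : PartialStateMRC.IsStabilizable A B)
    (hdetect : PartialStateMRC.IsDetectable A C)
    (hrank : PartialStateMRC.HasFullRank (PartialStateMRC.transferMatrix A B C))
    (hξ : PartialStateMRC.IsModifiedLeftInteractor ξ (PartialStateMRC.transferMatrix A B C))
    (hC₀ : C₀.rank = n₀)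
    (hobs : PartialStateMRC.IsObservable A C₀)
    (hΛ_monic : Λ.Monic) (hΛ_degree : Λ.natDegree = n - n₀)
    (hΛ_stable : PartialStateMRC.IsStablePoly Λ) :
    ∃ (Θ₁ : Matrix (Fin (n - n₀) × Fin M) (Fin M) ℝ)
      (Θ₂ : Matrix (Fin (n - n₀) × Fin n₀) (Fin M) ℝ)
      (Θ₂₀ : Matrix (Fin n₀) (Fin M) ℝ) (Θ₃ : Matrix (Fin M) (Fin M) ℝ),
      ∀ r : ℝ → Fin M → ℝ, Measurable r → PartialStateMRC.IsBoundedSignal r →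
        -- the closed loop and the reference model are well posed
        (∀ x₀ : Fin n → ℝ, ∃ x u ω₁ ω₂, x 0 = x₀ ∧
          PartialStateMRC.IsClosedLoop A B C₀ Λ Θ₁ Θ₂ Θ₂₀ Θ₃ r x u ω₁ ω₂) ∧
        (∃ y_m, PartialStateMRC.IsResponse
          (fun s => (PartialStateMRC.evalPolyMatrix ξ s)⁻¹) r y_m) ∧
        -- boundedness and output matching along all their solutions
        ∀ x u ω₁ ω₂ y_m,
          PartialStateMRC.IsClosedLoop A B C₀ Λ Θ₁ Θ₂ Θ₂₀ Θ₃ r x u ω₁ ω₂ →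
          PartialStateMRC.IsResponse (fun s => (PartialStateMRC.evalPolyMatrix ξ s)⁻¹) r y_m →
            PartialStateMRC.IsBoundedSignal x ∧
            PartialStateMRC.IsBoundedSignal u ∧
            PartialStateMRC.IsBoundedSignal (fun t => C *ᵥ x t) ∧
            PartialStateMRC.IsBoundedSignal (fun t => C₀ *ᵥ x t) ∧
            PartialStateMRC.IsBoundedSignal ω₁ ∧
            PartialStateMRC.IsBoundedSignal ω₂ ∧
            PartialStateMRC.IsExpDecaying (fun t => C *ᵥ x t - y_m t) := by
  obtain ⟨Kp, K, P, hKp, hP⟩ := hξ.exists_feedback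
  have hH : IsHurwitz (A + B * K) :=
    isHurwitz_of_feedback hzeros hstab hdetect hξ fun s => (hP s).1
  obtain ⟨N, N₂, N₀, hN⟩ := exists_observer_gains hobs hC₀ hΛ_monic hΛ_degree K
  refine ⟨(N * blockwise (n - n₀) B)ᵀ, N₂ᵀ, N₀ᵀ, Kp⁻¹, fun r hrm hrb => ?_⟩
  have hr := fun t ht => hrb.intervalIntegrable hrm (t := t) ht
  obtain ⟨xm, hxm⟩ := exists_hasVelocity_mulVec (A + B * K) (B * Kp⁻¹) hr
  have href := isResponse_reference hH hKp hP hr hxm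
  refine ⟨fun x₀ => exists_isClosedLoop A B C₀ hΛ_monic hΛ_degree hΛ_stable _ _ _ _ hr x₀,
    ⟨_, href⟩, fun x u ω₁ ω₂ ym hcl hym => ?_⟩
  obtain ⟨μ, hμ, he⟩ := exists_decaysAt_observer_error hΛ_monic hΛ_degree hΛ_stable hN hcl.plant
    hcl.filter_input hcl.filter_partial_state
  set e : ℝ → Fin M → ℝ := fun t => (N * blockwise (n - n₀) B) *ᵥ ω₁ t + N₂ *ᵥ ω₂ t +
      N₀ *ᵥ (C₀ *ᵥ x t) - K *ᵥ x t with he_def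
  have hu (t : ℝ) (ht : 0 ≤ t) : u t = K *ᵥ x t + (e t + Kp⁻¹ *ᵥ r t) := by
    rw [hcl.control t ht]
    simp only [he_def, Matrix.transpose_transpose]
    abel
  have hx : HasVelocity x
      (fun t => (A + B * K) *ᵥ x t + (B *ᵥ (e t + Kp⁻¹ *ᵥ r t))) :=
    hcl.plant.hasVelocity.congr (fun _ _ => rfl) fun t ht => by
      rw [hu t ht]
      simp only [Matrix.mulVec_add, Matrix.add_mulVec, Matrix.mulVec_mulVec]
      abel
  obtain ⟨μ₀, hμ₀, hrate⟩ := exists_rate hH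
  have hr0 := isBoundedSignal_iff_decaysAt_zero.1 hrb
  have hin : DecaysAt 0 (fun t => e t + Kp⁻¹ *ᵥ r t) := (he.mono hμ.le).add (hr0.mulVec _)
  have hx0 : DecaysAt 0 x := hrate 0 hμ₀.le _ _ hx (hin.mulVec B)
  have hu0 : DecaysAt 0 u := ((hx0.mulVec K).add hin).congr hu
  have hmatch : DecaysAt (min μ₀ μ) (fun t => x t - xm t) := by
    refine hrate _ (min_le_left _ _) _ (fun t => B *ᵥ e t)
      ((hx.sub hxm).congr (fun _ _ => rfl) fun t _ => ?_) ((he.mono (min_le_right _ _)).mulVec B)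
    simp only [Matrix.mulVec_sub, Matrix.mulVec_add, ← Matrix.mulVec_mulVec]
    abel
  obtain ⟨μ₁, hμ₁, hym'⟩ := href.exists_decaysAt_sub hym
  refine ⟨isBoundedSignal_iff_decaysAt_zero.2 hx0, isBoundedSignal_iff_decaysAt_zero.2 hu0,
    isBoundedSignal_iff_decaysAt_zero.2 (hx0.mulVec C),
    isBoundedSignal_iff_decaysAt_zero.2 (hx0.mulVec C₀),
    isBoundedSignal_iff_decaysAt_zero.2 (hcl.filter_input.isBounded hu0),
    isBoundedSignal_iff_decaysAt_zero.2 (hcl.filter_partial_state.isBounded (hx0.mulVec C₀)), ?_⟩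
  refine DecaysAt.isExpDecaying (lt_min (lt_min hμ₀ hμ) hμ₁)
    (((hmatch.mono (min_le_left _ μ₁)).mulVec C |>.add (hym'.mono (min_le_right _ _))).congr
      fun t _ => ?_)
  rw [Matrix.mulVec_sub, sub_add_sub_cancel]
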